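/- Let $p\ge 2$ be an integer. For a ring $R$, let $\mathscr H_R$ be the ring of Hahn series $f=\sum_{\gamma\in\mathbb Q}f_\gamma z^\gamma$ with coefficients $f_\gamma\in R$ and well-ordered support in $\mathbb Q$; write $\operatorname{val}_z(f)$ for the least element of the support of $f$ (and $+\infty$ if $f=0$), $\operatorname{cld}_z(f)$ for the coefficient of $z^{\operatorname{val}_z(f)}$ in $f\neq 0$, and $\phi_p\bigl(\sum f_\gamma z^\gamma\bigr)=\sum f_\gamma z^{p\gamma}$. Put $\mathscr H=\mathscr H_{\mathbb C}\subset\mathscr H_{\mathbb C(\lambda)}$. Let $\mathscr R_\lambda=\mathscr H_{\mathbb C(\lambda)}[X,\partial_\lambda X,\partial_\lambda^2X,\dots]$ be the ring of differential polynomials in one differential indeterminate $X=:e_\lambda$, where $\partial_\lambda$ extends $\frac{\partial}{\partial\lambda}$ on $\mathscr H_{\mathbb C(\lambda)}$, and extend $\phi_p$ to the ring endomorphism of $\mathscr R_\lambda$ with $\phi_p(\partial_\lambda^iX)=\partial_\lambda^i(\lambda X)$ for all $i\ge 0$; in particular $\phi_p(e_\lambda)=\lambda e_\lambda$. Let $L=a_n\phi_p^n+\cdots+a_1\phi_p+a_0$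 with $n\ge 0$, $a_0,\dots,a_n\in\mathscr H$ and $a_0a_n\ne0$; it acts on $\mathscr R_\lambda$. The Newton polygon of $L$ is the convex hull in $\mathbb R^2$ of $\{(p^i,y)\mid 0\le i\le n,\ a_i\neq 0,\ y\in\mathbb R,\ y\ge\operatorname{val}_z(a_i)\}$. Let $(p^{\alpha_i},\operatorname{val}_z(a_{\alpha_i}))$, $0\le i\le k$, with $0=\alpha_0<\alpha_1<\dots<\alpha_k=n$, be its vertices. For $1\le i\le k$, let $$\mu_i=\frac{\operatorname{val}_z(a_{\alpha_i})-\operatorname{val}_z(a_{\alpha_{i-1}})}{p^{\alpha_i}-p^{\alpha_{i-1}}},\qquad r_i=\alpha_i-\alpha_{i-1};$$ the $\mu_1<\dots<\mu_k$ are the slopes of $L$ and $r_i$ is the multiplicity of $\mu_i$. Put $b_l=z^{-(p^l-1)\mu_i}a_l$ for $0\le l\le n$ and $v=\min_{0\le l\le n}\operatorname{val}_z(b_l)$. The exponents $c_{i,1},\dots,c_{i,r_i}$ of $L$ attached to $\mu_i$ are the roots in $\mathbb C^\times$, repeated with multiplicities, of the characteristic polynomial $\bigl(z^{-v}\sum_{l=0}^n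 b_l(z)X^l\bigr)_{|z=0}\in\mathbb C[X]$. For $c\in\mathbb C^\times$, let $m_{c,i}$ be the number of $l\in\{1,\dots,r_i\}$ with $c_{i,l}=c$. Then for every slope $\mu_j$ ($1\le j\le k$) and every exponent $c$ attached to $\mu_j$, there exists a unique $g_{c,j}(\lambda,z)\in\mathscr H_{\mathbb C(\lambda)}$ such that $$L(g_{c,j}(\lambda,z)e_\lambda)=z^{\operatorname{val}_z(a_0)-\frac{\nu_j}{p-1}}(\lambda-c)^{s_{c,j}+m_{c,j}}e_\lambda,$$ where $s_{c,j}=m_{c,1}+\cdots+m_{c,j-1}$ and $$\nu_j=(p-1)\bigl(p^{r_1+\cdots+r_{j-1}}(\mu_j-\mu_{j-1})+\cdots+p^{r_1}(\mu_2-\mu_1)+\mu_1\bigr).$$ The coefficients of $g_{c,j}(\lambda,z)$ have no pole at $\lambda=c$. Moreover, $\operatorname{val}_z(g_{c,j}(\lambda,z))=-\mu_j$ and $$\operatorname{cld}_z g_{c,j}(\lambda,z)=\lambda^{-r_1-\cdots-r_{j-1}}\,\frac{\prod_{i=1}^{j}\prod_{l=1}^{r_i}(-c_{i,l})}{\operatorname{cld}_z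 a_0}\,\frac{(\lambda-c)^{s_{c,j}+m_{c,j}}}{\prod_{l=1}^{r_j}(\lambda-c_{j,l})}.$$ -/

import Mathlib

namespace Mahler

/-- The ring of Hahn series in `z` with coefficients in `R` and value group `ℚ`. -/
abbrev Hahn (R : Type) [Zero R] : Type := HahnSeries ℚ R

/-- The field `ℂ(λ)` of rational functions; the indeterminate `λ` is `RatFunc.X`. -/
abbrev RatLam : Type := RatFunc ℂ

/-- The Mahler operator `f(z) ↦ f(z ^ p)` on Hahn series, sending `∑ f_γ z ^ γ` to
`∑ f_γ z ^ (p γ)`. -/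
noncomputable def phi (R : Type) [Semiring R] (p : ℕ) (hp : 2 ≤ p) : Hahn R →+* Hahn R :=
  have hp0 : (0 : ℚ) < p := by exact_mod_cast (by omega : 0 < p)
  HahnSeries.embDomainRingHom (AddMonoidHom.mulLeft (p : ℚ))
    (mul_right_injective₀ hp0.ne') (fun _ _ => mul_le_mul_iff_of_pos_left hp0)

theorem phi_coeff (R : Type) [Semiring R] (p : ℕ) (hp : 2 ≤ p) (f : Hahn R) (γ : ℚ) :
    (phi R p hp f).coeff (p * γ) = f.coeff γ :=
  HahnSeries.embDomain_coeff

/-- The ring `ℋ_{ℂ(λ)}[X, ∂X, ∂²X, …]` of differential polynomials in one differential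
indeterminate; the variable of index `i` stands for `∂ ^ i X`, where `∂ = ∂ / ∂λ`. -/
abbrev RLam : Type := MvPolynomial ℕ (Hahn RatLam)

/-- The symbol `e_λ`, i.e. the differential indeterminate `X` itself. -/
noncomputable def eLam : RLam := MvPolynomial.X 0

/-- The embedding of Hahn series over `ℂ(λ)` into `RLam` as constant polynomials. -/
noncomputable def incl : Hahn RatLam →+* RLam := MvPolynomial.C

/-- The Mahler operator on `RLam`: it extends `f(λ, z) ↦ f(λ, z ^ p)` and sends `∂ ^ i X` to
`∂ ^ i (λ X)`, which is `λ ∂ ^ i X + i ∂ ^ (i - 1) X` by the Leibniz rule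
(for `i = 0` the second term vanishes). -/
noncomputable def phiLam (p : ℕ) (hp : 2 ≤ p) : RLam →+* RLam :=
  MvPolynomial.eval₂Hom (incl.comp (phi RatLam p hp)) fun i =>
    incl (HahnSeries.C RatFunc.X) * MvPolynomial.X i + (i : RLam) * MvPolynomial.X (i - 1)

/-- The inclusion of Hahn series over `ℂ` into Hahn series over `ℂ(λ)`. -/
noncomputable def toLam (f : Hahn ℂ) : Hahn RatLam := f.map (RatFunc.C : ℂ →+* RatLam)

/-- The action on `RLam` of the Mahler operator `L = ∑_{i ≤ n} a_i φ ^ i`, where `φ` is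
`phiLam`. -/
noncomputable def opLam (p : ℕ) (hp : 2 ≤ p) (n : ℕ) (a : ℕ → Hahn ℂ) (y : RLam) : RLam :=
  ∑ i ∈ Finset.range (n + 1), incl (toLam (a i)) * (phiLam p hp)^[i] y

/-- The Newton polygon of `L = ∑_{i ≤ n} a_i φ ^ i`: the convex hull of the vertical half-lines
above the points `(p ^ i, val a_i)` (there is none where `a_i = 0`, of valuation `+∞`). -/
def newtonPolygon (p n : ℕ) (a : ℕ → Hahn ℂ) : Set (ℝ × ℝ) :=
  convexHull ℝ {v | ∃ i ≤ n, a i ≠ 0 ∧ v.1 = (p : ℝ) ^ i ∧ ((a i).order : ℝ) ≤ v.2}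

/-- `(p ^ i, val a_i)` is a vertex of the Newton polygon. -/
def IsVertex (p n : ℕ) (a : ℕ → Hahn ℂ) (i : ℕ) : Prop :=
  i ≤ n ∧ a i ≠ 0 ∧
    ((p : ℝ) ^ i, ((a i).order : ℝ)) ∈ (newtonPolygon p n a).extremePoints ℝ

/-- The number `k` of slopes: one less than the number of vertices. -/
noncomputable def numSlopes (p n : ℕ) (a : ℕ → Hahn ℂ) : ℕ :=
  {i | IsVertex p n a i}.ncard - 1

/-- The exponents `α_0 < α_1 < ⋯ < α_k` of the abscissae `p ^ α_j` of the vertices. -/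
noncomputable def alpha (p n : ℕ) (a : ℕ → Hahn ℂ) (j : ℕ) : ℕ := Nat.nth (IsVertex p n a) j

/-- The slope `μ_j`, for `1 ≤ j ≤ k`: the slope of the edge from the vertex of abscissa
`p ^ α_{j - 1}` to that of abscissa `p ^ α_j`. -/
noncomputable def slope (p n : ℕ) (a : ℕ → Hahn ℂ) (j : ℕ) : ℚ :=
  ((a (alpha p n a j)).order - (a (alpha p n a (j - 1))).order) /
    ((p : ℚ) ^ alpha p n a j - (p : ℚ) ^ alpha p n a (j - 1))

/-- The multiplicity `r_j = α_j - α_{j - 1}` of the slope `μ_j`, for `1 ≤ j ≤ k`. -/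
noncomputable def slopeMult (p n : ℕ) (a : ℕ → Hahn ℂ) (j : ℕ) : ℕ :=
  alpha p n a j - alpha p n a (j - 1)

/-- The sum `r_1 + ⋯ + r_{j - 1}`. -/
noncomputable def slopeMultSum (p n : ℕ) (a : ℕ → Hahn ℂ) (j : ℕ) : ℕ :=
  ∑ i ∈ Finset.Ico 1 j, slopeMult p n a i

/-- `ν_j = (p - 1) (p ^ (r_1 + ⋯ + r_{j - 1}) (μ_j - μ_{j - 1}) + ⋯ + p ^ r_1 (μ_2 - μ_1) + μ_1)`,
for `1 ≤ j ≤ k`. -/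
noncomputable def nu (p n : ℕ) (a : ℕ → Hahn ℂ) (j : ℕ) : ℚ :=
  ((p : ℚ) - 1) *
    (∑ i ∈ Finset.Icc 2 j,
        (p : ℚ) ^ slopeMultSum p n a i * (slope p n a i - slope p n a (i - 1))
      + slope p n a 1)

/-- The coefficients of the gauge transform `θ⁻¹ L θ`, with `θ = z ^ (μ / (p - 1))`: that of `φ ^ i`
is `z ^ ((p ^ i - 1) / (p - 1) * μ) a_i`. -/
noncomputable def gauge (p : ℕ) (μ : ℚ) (a : ℕ → Hahn ℂ) (i : ℕ) : Hahn ℂ :=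
  HahnSeries.single (((p : ℚ) ^ i - 1) / ((p : ℚ) - 1) * μ) (1 : ℂ) * a i

/-- The valuation `min_{i ≤ n} val b_i` of an operator `∑_{i ≤ n} b_i φ ^ i` (as a rational
number; it is only used for operators that are not zero). -/
noncomputable def opVal (n : ℕ) (b : ℕ → Hahn ℂ) : ℚ :=
  ((Finset.range (n + 1)).inf fun i => (b i).orderTop).untopD 0

/-- The characteristic polynomial attached to the slope `μ_j`: with `b` the coefficients of the
gauge transform of `L` by `θ = z ^ (-μ_j)` and `v` its valuation, the value of
`z ^ (-v) ∑_i b_i X ^ i` at `z = 0`. -/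
noncomputable def charPoly (p n : ℕ) (a : ℕ → Hahn ℂ) (j : ℕ) : Polynomial ℂ :=
  let b := gauge p (-((p : ℚ) - 1) * slope p n a j) a
  ∑ i ∈ Finset.range (n + 1),
    Polynomial.monomial i ((HahnSeries.single (-opVal n b) (1 : ℂ) * b i).coeff 0)

/-- The exponents attached to the slope `μ_j`, with multiplicities: the nonzero complex roots of
the characteristic polynomial. -/
noncomputable def exponents (p n : ℕ) (a : ℕ → Hahn ℂ) (j : ℕ) : Multiset ℂ :=
  (charPoly p n a j).roots.filter fun c => c ≠ 0

/-- The multiplicity `m_{c, j}` of `c` as an exponent attached to `μ_j` (`0` if `c` is not one). -/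
noncomputable def expMult (p n : ℕ) (a : ℕ → Hahn ℂ) (c : ℂ) (j : ℕ) : ℕ :=
  (exponents p n a j).count c

/-- `s_{c, j} = m_{c, 1} + ⋯ + m_{c, j - 1}`. -/
noncomputable def expMultSum (p n : ℕ) (a : ℕ → Hahn ℂ) (c : ℂ) (j : ℕ) : ℕ :=
  ∑ i ∈ Finset.Ico 1 j, expMult p n a c i

/-- The rational function `f` has no pole at `λ = c`. -/
def NoPoleAt (f : RatLam) (c : ℂ) : Prop := f.denom.eval c ≠ 0

/-- `g ∈ ℋ_{ℂ(λ)}` satisfies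
`L (g e_λ) = z ^ (val a_0 - ν_j / (p - 1)) (λ - c) ^ (s_{c, j} + m_{c, j}) e_λ`. -/
def FrobeniusEq (p : ℕ) (hp : 2 ≤ p) (n : ℕ) (a : ℕ → Hahn ℂ) (j : ℕ) (c : ℂ)
    (g : Hahn RatLam) : Prop :=
  opLam p hp n a (incl g * eLam) =
    incl (HahnSeries.single ((a 0).order - nu p n a j / ((p : ℚ) - 1))
      ((RatFunc.X - RatFunc.C c) ^ (expMultSum p n a c j + expMult p n a c j))) * eLam

end Mahler

/-! On multiples of `eLam` the operator acts through the additive map `M : g ↦ ∑ a_i λ ^ i φ ^ i g`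
on Hahn series (`opLam_incl_mul_eLam`), so the whole problem lives there. `M` sends `x z ^ γ` to
`χ_γ(λ) x z ^ π(γ)` plus higher terms, where `π(γ) = min_i (val a_i + p ^ i γ)` and the polynomial
`χ_γ` collects the leading coefficients of the `a_i` that attain the minimum
(`mahlerOp_isTriangular`). Since `π` is an increasing bijection of `ℚ` and `χ_γ ≠ 0`, `M` is
bijective, which gives existence and uniqueness.

The Newton polygon describes `χ_γ`: it is a monomial unless `γ = -μ_i` for some `i`, and there it is
a monomial times a polynomial whose roots are the `c_{i,l}` (`exists_charPoly_eq`). As `val a_0 -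
ν_j / (p - 1) = π(-μ_j)` (`order_sub_nu_eq_minHeight`), the solution has valuation `-μ_j` and
leading coefficient `(λ - c) ^ (s + m) / χ_{-μ_j}`.

For the poles, solving for the coefficient of `z ^ γ` means dividing by `χ_γ`. This lowers the order
of vanishing at `c` by `m_{c,i}` when `γ = -μ_i`, and by nothing otherwise. From `-μ_j` upwards only
`-μ_j < ⋯ < -μ_1` are met, and the factor `(λ - c) ^ (m_{c,1} + ⋯ + m_{c,j})` on the right pays for
all of them (`FrobeniusEq.coeff_mem`). -/

namespace Mahler

/-! ### Lowest coefficient of a product of Hahn series. -/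

section HahnProducts

variable {R : Type} [Semiring R] {f g : Hahn R} {α β : ℚ}

theorem coeff_mul_eq_zero_of_lt (hf : ∀ δ < α, f.coeff δ = 0) (hg : ∀ δ < β, g.coeff δ = 0)
    {δ : ℚ} (hδ : δ < α + β) : (f * g).coeff δ = 0 := by
  rw [HahnSeries.coeff_mul]
  refine Finset.sum_eq_zero fun x hx => ?_
  have hx' := (Finset.mem_antidiagonal.1 hx).2.2
  by_cases h : x.1 < α
  · rw [hf _ h, zero_mul]
  · rw [hg x.2 (by linarith), mul_zero]

theorem coeff_mul_add_of_vanish (hf : ∀ δ < α, f.coeff δ = 0) (hg : ∀ δ < β, g.coeff δ = 0) :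
    (f * g).coeff (α + β) = f.coeff α * g.coeff β := by
  rw [HahnSeries.coeff_mul, Finset.sum_eq_single (α, β)]
  · intro x hx hne
    have hx' := (Finset.mem_antidiagonal.1 hx).2.2
    by_cases h : x.1 < α
    · rw [hf _ h, zero_mul]
    · by_cases h' : x.2 < β
      · rw [hg _ h', mul_zero]
      · exact absurd (Prod.ext (by simp; linarith) (by simp; linarith)) hne
  · intro hx
    by_contra hne
    exact hx (Finset.mem_antidiagonal.2
      ⟨fun h => hne (by simp [h]), fun h => hne (by simp [h]), rfl⟩)

end HahnProducts

/-! ### Bijectivity of triangular operators on Hahn series. -/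

section TriangularOperators

variable {K : Type} [Field K] (M : Hahn K →+ Hahn K) (π : ℚ → ℚ) (χ : ℚ → K)

/-- An additive operator on Hahn series that moves the exponent `γ` to `π γ`, multiplying the
coefficient by `χ γ`, up to terms of higher order. -/
structure IsTriangular : Prop where
  strictMono : StrictMono π
  surjective : Function.Surjective π
  ne_zero : ∀ γ, χ γ ≠ 0
  coeff_eq_zero : ∀ f γ, (∀ δ < γ, f.coeff δ = 0) → ∀ δ < π γ, (M f).coeff δ = 0
  coeff_lead : ∀ f γ, (∀ δ < γ, f.coeff δ = 0) → (M f).coeff (π γ) = χ γ * f.coeff γ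

variable {M π χ}

theorem coeff_eq_zero_of_order_eq {f : Hahn K} {γ : ℚ} (h : f.order = γ) :
    ∀ δ < γ, f.coeff δ = 0 := fun _ hδ => HahnSeries.coeff_eq_zero_of_lt_order (h ▸ hδ)

theorem IsTriangular.coeff_order (hM : IsTriangular M π χ) {f : Hahn K} (hf : f ≠ 0) :
    (M f).coeff (π f.order) ≠ 0 := by
  rw [hM.coeff_lead f _ (coeff_eq_zero_of_order_eq rfl)]
  exact mul_ne_zero (hM.ne_zero _) (HahnSeries.coeff_order_eq_zero.not.2 hf)

theorem IsTriangular.injective (hM : IsTriangular M π χ) : Function.Injective M := by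
  rw [injective_iff_map_eq_zero]
  intro f hf
  by_contra h0
  exact hM.coeff_order h0 (by rw [hf, HahnSeries.coeff_zero])

theorem IsTriangular.agree (hM : IsTriangular M π χ) {f g : Hahn K} {γ : ℚ}
    (h : ∀ δ < π γ, (M f).coeff δ = (M g).coeff δ) : ∀ δ < γ, f.coeff δ = g.coeff δ := by
  intro δ hδ
  by_contra hne
  have hne' : (f - g).coeff δ ≠ 0 := by rwa [HahnSeries.coeff_sub, sub_ne_zero]
  have h0 : f - g ≠ 0 := HahnSeries.ne_zero_of_coeff_ne_zero hne'
  have hle : (f - g).order ≤ δ := HahnSeries.order_le_of_coeff_ne_zero hne'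
  refine hM.coeff_order h0 ?_
  rw [map_sub, HahnSeries.coeff_sub, h _ (hM.strictMono (hle.trans_lt hδ)), sub_self]

theorem IsTriangular.coeff_congr (hM : IsTriangular M π χ) {f g : Hahn K} {γ : ℚ}
    (h : ∀ δ < γ, f.coeff δ = g.coeff δ) : ∀ δ < π γ, (M f).coeff δ = (M g).coeff δ := by
  intro δ hδ
  have := hM.coeff_eq_zero (f - g) γ (fun ε hε => by simp [h ε hε]) δ hδ
  rwa [map_sub, HahnSeries.coeff_sub, sub_eq_zero] at this

/-- Compatible approximations can be glued to a Hahn series. -/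
theorem exists_glue (I : Set ℚ) (F : ℚ → Hahn K)
    (hF : ∀ γ ∈ I, ∀ γ' ∈ I, ∀ δ, δ < γ → δ < γ' → (F γ).coeff δ = (F γ').coeff δ) :
    ∃ g : Hahn K, ∀ γ ∈ I, ∀ δ < γ, g.coeff δ = (F γ).coeff δ := by
  classical
  let c : ℚ → K := fun δ => if h : ∃ γ ∈ I, δ < γ then (F h.choose).coeff δ else 0
  have hc : ∀ γ ∈ I, ∀ δ < γ, c δ = (F γ).coeff δ := by
    intro γ hγ δ hδ
    have h : ∃ γ ∈ I, δ < γ := ⟨γ, hγ, hδ⟩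
    simp only [c, dif_pos h]
    exact hF _ h.choose_spec.1 _ hγ _ h.choose_spec.2 hδ
  -- A descending sequence in the support stays below any `γ` exceeding its first term, hence lies
  -- in the support of the single series `F γ`.
  have hwf : (Function.support c).IsWF := by
    rw [Set.isWF_iff_no_descending_seq]
    intro s hs hmem
    have h0 : ∃ γ ∈ I, s 0 < γ := by
      by_contra h
      exact hmem 0 (by simp only [c, dif_neg h])
    obtain ⟨γ, hγ, h0⟩ := h0
    refine Set.isWF_iff_no_descending_seq.1 (F γ).isWF_support s hs fun n => ?_
    have : s n < γ := (hs.antitone (Nat.zero_le n)).trans_lt h0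
    rw [HahnSeries.mem_support, ← hc γ hγ _ this]
    exact hmem n
  exact ⟨⟨c, hwf.isPWO⟩, hc⟩

/-- `I` is the set of `γ` up to which the equation can be solved. Solutions agree where they overlap
(`IsTriangular.agree`), so they glue to one `g` correct up to every `γ ∈ I`. If `h - M g` had order
`π γ₀`, one more term at `γ₀` would either solve the equation or put some `γ₁ > γ₀` in `I`, and then
`g` would already be correct at `π γ₀`. -/
theorem IsTriangular.surjective_op (hM : IsTriangular M π χ) : Function.Surjective M := by
  intro h
  let P : ℚ → Hahn K → Prop := fun γ g => ∀ δ < π γ, (M g).coeff δ = h.coeff δ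
  let I : Set ℚ := {γ | ∃ g, P γ g}
  choose! F hF using fun γ (hγ : γ ∈ I) => hγ
  obtain ⟨g, hg⟩ := exists_glue I F fun γ hγ γ' hγ' δ h1 h2 => by
    refine hM.agree (γ := min γ γ') (fun ε hε => ?_) δ (lt_min h1 h2)
    rw [hF γ hγ ε (hε.trans_le (hM.strictMono.monotone (min_le_left _ _))),
      hF γ' hγ' ε (hε.trans_le (hM.strictMono.monotone (min_le_right _ _)))]
  have hgI : ∀ γ ∈ I, P γ g := fun γ hγ δ hδ => by
    rw [hM.coeff_congr (hg γ hγ) δ hδ, hF γ hγ δ hδ]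
  by_cases hr : h - M g = 0
  · exact ⟨g, (sub_eq_zero.1 hr).symm⟩
  obtain ⟨γ₀, hγ₀⟩ := hM.surjective (h - M g).order
  let x : K := (h - M g).coeff (π γ₀) / χ γ₀
  have hsingle : ∀ δ < γ₀, (HahnSeries.single γ₀ x).coeff δ = 0 := fun δ hδ =>
    HahnSeries.coeff_single_of_ne hδ.ne
  have hlow : ∀ δ ≤ π γ₀, (h - M (g + HahnSeries.single γ₀ x)).coeff δ = 0 := by
    intro δ hδ
    rw [map_add, ← sub_sub, HahnSeries.coeff_sub]
    rcases hδ.lt_or_eq with hlt | rfl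
    · rw [hM.coeff_eq_zero _ _ hsingle δ hlt,
        HahnSeries.coeff_eq_zero_of_lt_order (hγ₀ ▸ hlt), sub_zero]
    · rw [hM.coeff_lead _ _ hsingle, HahnSeries.coeff_single_same,
        mul_div_cancel₀ _ (hM.ne_zero γ₀), sub_self]
  by_cases hr' : h - M (g + HahnSeries.single γ₀ x) = 0
  · exact ⟨_, (sub_eq_zero.1 hr').symm⟩
  exfalso
  obtain ⟨γ₁, hγ₁⟩ := hM.surjective (h - M (g + HahnSeries.single γ₀ x)).order
  have hlt : π γ₀ < π γ₁ := by
    rw [hγ₁]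
    by_contra hle
    exact hr' (HahnSeries.coeff_order_eq_zero.1 (hlow _ (not_lt.1 hle)))
  have hI : γ₁ ∈ I := ⟨g + HahnSeries.single γ₀ x, fun δ hδ => by
    have := HahnSeries.coeff_eq_zero_of_lt_order (hγ₁ ▸ hδ)
    rw [HahnSeries.coeff_sub, sub_eq_zero] at this
    exact this.symm⟩
  have := hgI γ₁ hI _ hlt
  refine HahnSeries.coeff_order_eq_zero.not.2 hr ?_
  rw [← hγ₀, HahnSeries.coeff_sub, this, sub_self]

theorem IsTriangular.order_map (hM : IsTriangular M π χ) {f : Hahn K} (hf : f ≠ 0) :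
    (M f).order = π f.order := by
  have h := hM.coeff_order hf
  refine le_antisymm (HahnSeries.order_le_of_coeff_ne_zero h) (not_lt.1 fun hlt => ?_)
  exact HahnSeries.coeff_order_eq_zero.not.2 (HahnSeries.ne_zero_of_coeff_ne_zero h)
    (hM.coeff_eq_zero f _ (coeff_eq_zero_of_order_eq rfl) _ hlt)

end TriangularOperators

/-! ### Reduction to an operator on Hahn series. -/

section MahlerOperator

variable (p : ℕ) (hp : 2 ≤ p)

theorem coeff_phi_iterate {R : Type} [Semiring R] (i : ℕ) (f : Hahn R) (γ : ℚ) :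
    ((phi R p hp)^[i] f).coeff γ = f.coeff (γ / (p : ℚ) ^ i) := by
  have hp0 : (p : ℚ) ≠ 0 := by exact_mod_cast (by omega : p ≠ 0)
  induction i generalizing γ with
  | zero => simp
  | succ i ih =>
    rw [Function.iterate_succ_apply', show γ = p * (γ / p) by field_simp, phi_coeff, ih]
    congr 1
    field_simp
    ring

theorem toLam_coeff (f : Hahn ℂ) (γ : ℚ) : (toLam f).coeff γ = RatFunc.C (f.coeff γ) := rfl

/-- The operator `g ↦ ∑ a_i λ ^ i φ ^ i g` on Hahn series over `ℂ(λ)`. -/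
noncomputable def mahlerOp (n : ℕ) (a : ℕ → Hahn ℂ) : Hahn RatLam →+ Hahn RatLam where
  toFun g := ∑ i ∈ Finset.range (n + 1),
    toLam (a i) * (HahnSeries.C (RatFunc.X ^ i) * (phi RatLam p hp)^[i] g)
  map_zero' := by simp [iterate_map_zero]
  map_add' f g := by simp [iterate_map_add, mul_add, Finset.sum_add_distrib]

theorem mahlerOp_apply (n : ℕ) (a : ℕ → Hahn ℂ) (g : Hahn RatLam) :
    mahlerOp p hp n a g = ∑ i ∈ Finset.range (n + 1),
      toLam (a i) * (HahnSeries.C (RatFunc.X ^ i) * (phi RatLam p hp)^[i] g) := rfl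

theorem phi_C (x : RatLam) : phi RatLam p hp (HahnSeries.C x) = HahnSeries.C x := by
  have : phi RatLam p hp (HahnSeries.C x) = HahnSeries.single ((p : ℚ) * 0) x :=
    HahnSeries.embDomain_single
  rw [this, mul_zero]; rfl

theorem phiLam_incl_mul_eLam (g : Hahn RatLam) :
    phiLam p hp (incl g * eLam) =
      incl (HahnSeries.C RatFunc.X * phi RatLam p hp g) * eLam := by
  simp only [phiLam, incl, eLam, map_mul, MvPolynomial.coe_eval₂Hom, MvPolynomial.eval₂_C,
    MvPolynomial.eval₂_X, RingHom.comp_apply, Nat.cast_zero, zero_mul, add_zero]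
  ring

theorem phiLam_iterate (i : ℕ) (g : Hahn RatLam) :
    (phiLam p hp)^[i] (incl g * eLam) =
      incl (HahnSeries.C (RatFunc.X ^ i) * (phi RatLam p hp)^[i] g) * eLam := by
  induction i with
  | zero => simp
  | succ i ih =>
    rw [Function.iterate_succ_apply', Function.iterate_succ_apply', ih, phiLam_incl_mul_eLam,
      map_mul (phi RatLam p hp), phi_C, ← mul_assoc, ← map_mul, pow_succ']

theorem opLam_incl_mul_eLam (n : ℕ) (a : ℕ → Hahn ℂ) (g : Hahn RatLam) :
    opLam p hp n a (incl g * eLam) = incl (mahlerOp p hp n a g) * eLam := by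
  simp only [opLam, mahlerOp_apply, phiLam_iterate, map_sum, map_mul, Finset.sum_mul]
  refine Finset.sum_congr rfl fun i _ => ?_
  ring

theorem opLam_eq_iff (n : ℕ) (a : ℕ → Hahn ℂ) (g h : Hahn RatLam) :
    opLam p hp n a (incl g * eLam) = incl h * eLam ↔ mahlerOp p hp n a g = h := by
  have h0 : eLam ≠ 0 := MvPolynomial.X_ne_zero 0
  rw [opLam_incl_mul_eLam, mul_left_inj' h0]
  exact (MvPolynomial.C_injective _ _).eq_iff

end MahlerOperator

/-! ### The exponent map `π`, the polynomials `χ_γ`, and triangularity. -/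

section Heights

variable (p n : ℕ) (a : ℕ → Hahn ℂ)

theorem opVal_spec {b : ℕ → Hahn ℂ} (h : ∃ i ≤ n, b i ≠ 0) :
    (∀ i ≤ n, b i ≠ 0 → opVal n b ≤ (b i).order) ∧
      ∃ i ≤ n, b i ≠ 0 ∧ opVal n b = (b i).order := by
  obtain ⟨k, hk, hbk⟩ := h
  obtain ⟨m, hm, he⟩ := Finset.exists_mem_eq_inf (Finset.range (n + 1)) ⟨0, by simp⟩
    fun i => (b i).orderTop
  have hle : ∀ i ≤ n, (b m).orderTop ≤ (b i).orderTop := fun i hi =>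
    he ▸ Finset.inf_le (f := fun i => (b i).orderTop) (Finset.mem_range.2 (Nat.lt_succ_of_le hi))
  have hbm : b m ≠ 0 := fun h0 => by
    have := hle k hk
    rw [h0, HahnSeries.orderTop_zero, top_le_iff, HahnSeries.orderTop_eq_top] at this
    exact hbk this
  have hval : opVal n b = (b m).order := by
    rw [opVal, he, ← HahnSeries.order_eq_orderTop_of_ne_zero hbm, WithTop.untopD_coe]
  refine ⟨fun i hi hbi => ?_, m, Nat.lt_succ_iff.1 (Finset.mem_range.1 hm), hbm, hval⟩
  have := hle i hi
  rw [← HahnSeries.order_eq_orderTop_of_ne_zero hbm,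
    ← HahnSeries.order_eq_orderTop_of_ne_zero hbi, WithTop.coe_le_coe] at this
  rwa [hval]

/-- The valuation of `z ^ (p ^ i γ) a_i`. -/
noncomputable def height (γ : ℚ) (i : ℕ) : ℚ := (a i).order + (p : ℚ) ^ i * γ

/-- The index `i` realises the minimum of the valuations of the `z ^ (p ^ i γ) a_i`. -/
def IsMinIndex (γ : ℚ) (i : ℕ) : Prop :=
  i ≤ n ∧ a i ≠ 0 ∧ ∀ l ≤ n, a l ≠ 0 → height p a γ i ≤ height p a γ l

/-- The least valuation of the `z ^ (p ^ i γ) a_i`. -/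
noncomputable def minHeight (γ : ℚ) : ℚ :=
  opVal n fun i => HahnSeries.single ((p : ℚ) ^ i * γ) (1 : ℂ) * a i

/-- The polynomial of the leading coefficients of the `z ^ (p ^ i γ) a_i` of least valuation. -/
noncomputable def charPolyAt (γ : ℚ) : Polynomial ℂ :=
  ∑ i ∈ Finset.range (n + 1),
    Polynomial.monomial i ((a i).coeff (minHeight p n a γ - (p : ℚ) ^ i * γ))

theorem order_single_mul {b : Hahn ℂ} (hb : b ≠ 0) (x : ℚ) :
    (HahnSeries.single x (1 : ℂ) * b).order = b.order + x := by
  rw [HahnSeries.order_mul (HahnSeries.single_ne_zero one_ne_zero) hb,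
    HahnSeries.order_single one_ne_zero, add_comm]

theorem single_mul_ne_zero {b : Hahn ℂ} (x : ℚ) :
    HahnSeries.single x (1 : ℂ) * b ≠ 0 ↔ b ≠ 0 := by
  simp

variable {p n a}

theorem minHeight_le (γ : ℚ) {i : ℕ} (hi : i ≤ n) (hai : a i ≠ 0) :
    minHeight p n a γ ≤ height p a γ i := by
  have := (opVal_spec n (b := fun i => HahnSeries.single ((p : ℚ) ^ i * γ) (1 : ℂ) * a i)
    ⟨i, hi, (single_mul_ne_zero _).2 hai⟩).1 i hi
    ((single_mul_ne_zero _).2 hai)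
  rwa [order_single_mul hai] at this

theorem exists_isMinIndex (h0 : a 0 ≠ 0) (γ : ℚ) : ∃ i, IsMinIndex p n a γ i := by
  obtain ⟨i, hi, hne, he⟩ := (opVal_spec n
    (b := fun i => HahnSeries.single ((p : ℚ) ^ i * γ) (1 : ℂ) * a i)
    ⟨0, Nat.zero_le n, (single_mul_ne_zero _).2 h0⟩).2
  have hai := (single_mul_ne_zero _).1 hne
  rw [order_single_mul hai] at he
  exact ⟨i, hi, hai, fun l hl hal => he.ge.trans (minHeight_le γ hl hal)⟩

theorem IsMinIndex.height_eq {γ : ℚ} {i : ℕ} (h : IsMinIndex p n a γ i) :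
    height p a γ i = minHeight p n a γ := by
  refine le_antisymm ?_ (minHeight_le γ h.1 h.2.1)
  obtain ⟨m, hm, hne, he⟩ := (opVal_spec n
    (b := fun i => HahnSeries.single ((p : ℚ) ^ i * γ) (1 : ℂ) * a i)
    ⟨i, h.1, (single_mul_ne_zero _).2 h.2.1⟩).2
  have ham := (single_mul_ne_zero _).1 hne
  rw [order_single_mul ham] at he
  exact (h.2.2 m hm ham).trans he.ge

theorem isMinIndex_of_height_eq {γ : ℚ} {i : ℕ} (hi : i ≤ n) (hai : a i ≠ 0)
    (h : height p a γ i = minHeight p n a γ) : IsMinIndex p n a γ i :=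
  ⟨hi, hai, fun _ hl hal => h ▸ minHeight_le γ hl hal⟩

theorem coeff_charPolyAt (γ : ℚ) (i : ℕ) : (charPolyAt p n a γ).coeff i =
    if i ≤ n then (a i).coeff (minHeight p n a γ - (p : ℚ) ^ i * γ) else 0 := by
  simp only [charPolyAt, Polynomial.finsetSum_coeff, Polynomial.coeff_monomial,
    Finset.sum_ite_eq', Finset.mem_range, Nat.lt_succ_iff]

theorem IsMinIndex.coeff_charPolyAt {γ : ℚ} {i : ℕ} (h : IsMinIndex p n a γ i) :
    (charPolyAt p n a γ).coeff i = (a i).leadingCoeff := by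
  rw [Mahler.coeff_charPolyAt, if_pos h.1, ← h.height_eq, height, add_sub_cancel_right,
    HahnSeries.leadingCoeff_eq]

/-- This is the dictionary between the polygon and `χ_γ`: monomials of `χ_γ` correspond to points on
the supporting line of slope `-γ`. -/
theorem coeff_charPolyAt_ne_zero {γ : ℚ} {i : ℕ} :
    (charPolyAt p n a γ).coeff i ≠ 0 ↔ IsMinIndex p n a γ i := by
  refine ⟨fun h => ?_, fun h => ?_⟩
  · rw [coeff_charPolyAt] at h
    have hi : i ≤ n := by
      by_contra hi
      exact h (if_neg hi)
    rw [if_pos hi] at h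
    have hai := HahnSeries.ne_zero_of_coeff_ne_zero h
    refine isMinIndex_of_height_eq hi hai (le_antisymm ?_ (minHeight_le γ hi hai))
    have := HahnSeries.order_le_of_coeff_ne_zero h
    rw [height]
    linarith
  · rw [h.coeff_charPolyAt]
    exact HahnSeries.leadingCoeff_ne_zero.2 h.2.1

theorem charPolyAt_ne_zero (h0 : a 0 ≠ 0) (γ : ℚ) : charPolyAt p n a γ ≠ 0 := by
  obtain ⟨i, hi⟩ := exists_isMinIndex (p := p) (n := n) h0 γ
  intro h
  exact coeff_charPolyAt_ne_zero.2 hi (by rw [h, Polynomial.coeff_zero])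

theorem minHeight_strictMono (hp : 2 ≤ p) (h0 : a 0 ≠ 0) : StrictMono (minHeight p n a) := by
  intro γ γ' h
  obtain ⟨i, hi⟩ := exists_isMinIndex (p := p) (n := n) h0 γ'
  rw [← hi.height_eq]
  refine (minHeight_le γ hi.1 hi.2.1).trans_lt ?_
  have : (0 : ℚ) < (p : ℚ) ^ i := pow_pos (by exact_mod_cast (by omega : 0 < p)) i
  rw [height, height]
  gcongr

theorem minHeight_surjective (hp : 2 ≤ p) (h0 : a 0 ≠ 0) :
    Function.Surjective (minHeight p n a) := by
  classical
  intro ρ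
  have hpos : ∀ i, (0 : ℚ) < (p : ℚ) ^ i := pow_pos (by exact_mod_cast (by omega : 0 < p))
  -- The inverse of a minimum of increasing affine bijections is the maximum of their inverses.
  obtain ⟨i, hi, hmax⟩ := Finset.exists_max_image ((Finset.range (n + 1)).filter (a · ≠ 0))
    (fun i => (ρ - (a i).order) / (p : ℚ) ^ i) ⟨0, by simp [h0]⟩
  simp only [Finset.mem_filter, Finset.mem_range, Nat.lt_succ_iff] at hi hmax
  have he : height p a ((ρ - (a i).order) / (p : ℚ) ^ i) i = ρ := by
    rw [height, mul_div_cancel₀ _ (hpos i).ne']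
    ring
  refine ⟨(ρ - (a i).order) / (p : ℚ) ^ i, ?_⟩
  have hmin : IsMinIndex p n a ((ρ - (a i).order) / (p : ℚ) ^ i) i := by
    refine ⟨hi.1, hi.2, fun l hl hal => ?_⟩
    have := hmax l ⟨hl, hal⟩
    rw [div_le_iff₀ (hpos l)] at this
    rw [he, height]
    linarith
  rw [← hmin.height_eq, he]

theorem algebraMap_charPolyAt (γ : ℚ) :
    algebraMap (Polynomial ℂ) RatLam (charPolyAt p n a γ) = ∑ i ∈ Finset.range (n + 1),
      RatFunc.C ((a i).coeff (minHeight p n a γ - (p : ℚ) ^ i * γ)) * RatFunc.X ^ i := by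
  rw [charPolyAt, map_sum]
  refine Finset.sum_congr rfl fun i _ => ?_
  rw [← Polynomial.C_mul_X_pow_eq_monomial, map_mul, map_pow, RatFunc.algebraMap_X,
    RatFunc.algebraMap_C]

/-- If `f` has no term below `γ`, then `a_i` starts no earlier than `π γ - p ^ i γ` and `λ ^ i φ ^ i
f` no earlier than `p ^ i γ`. Each summand thus starts no earlier than `π γ`, where only the product
of the two boundary coefficients survives. -/
theorem mahlerOp_isTriangular (hp : 2 ≤ p) (h0 : a 0 ≠ 0) :
    IsTriangular (mahlerOp p hp n a) (minHeight p n a)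
      fun γ => algebraMap (Polynomial ℂ) RatLam (charPolyAt p n a γ) := by
  have hpos : ∀ i, (0 : ℚ) < (p : ℚ) ^ i := pow_pos (by exact_mod_cast (by omega : 0 < p))
  have ha : ∀ γ, ∀ i ∈ Finset.range (n + 1), ∀ δ < minHeight p n a γ - (p : ℚ) ^ i * γ,
      (toLam (a i)).coeff δ = 0 := by
    intro γ i hi δ hδ
    rw [toLam_coeff, (map_eq_zero _)]
    by_cases hai : a i = 0
    · rw [hai, HahnSeries.coeff_zero]
    · refine HahnSeries.coeff_eq_zero_of_lt_order (hδ.trans_le ?_)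
      have := minHeight_le (p := p) γ (Nat.lt_succ_iff.1 (Finset.mem_range.1 hi)) hai
      rw [height] at this
      linarith
  have hphi : ∀ (f : Hahn RatLam) (γ : ℚ), (∀ δ < γ, f.coeff δ = 0) → ∀ i, ∀ δ < (p : ℚ) ^ i * γ,
      (HahnSeries.C (RatFunc.X ^ i) * (phi RatLam p hp)^[i] f).coeff δ = 0 := by
    intro f γ hf i δ hδ
    rw [HahnSeries.C_mul_eq_smul, HahnSeries.coeff_smul, coeff_phi_iterate,
      hf _ ((div_lt_iff₀' (hpos i)).2 hδ), smul_zero]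
  refine ⟨minHeight_strictMono hp h0, minHeight_surjective hp h0, fun γ => ?_,
    fun f γ hf δ hδ => ?_, fun f γ hf => ?_⟩
  · exact (map_ne_zero_iff _ (RatFunc.algebraMap_injective ℂ)).2 (charPolyAt_ne_zero h0 γ)
  · rw [mahlerOp_apply, HahnSeries.coeff_sum]
    refine Finset.sum_eq_zero fun i hi => ?_
    exact coeff_mul_eq_zero_of_lt (ha γ i hi) (hphi f γ hf i) (by linarith)
  · rw [mahlerOp_apply, HahnSeries.coeff_sum, algebraMap_charPolyAt, Finset.sum_mul]
    refine Finset.sum_congr rfl fun i hi => ?_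
    have := coeff_mul_add_of_vanish (ha γ i hi) (hphi f γ hf i)
    rw [sub_add_cancel] at this
    rw [this, toLam_coeff, HahnSeries.C_mul_eq_smul, HahnSeries.coeff_smul, coeff_phi_iterate,
      mul_div_cancel_left₀ _ (hpos i).ne', smul_eq_mul, mul_assoc]

/-- The gauge multiplies `a_i` by `z ^ (-(p ^ i - 1) μ)` instead of `z ^ (-p ^ i μ)`. The
discrepancy `z ^ μ` does not depend on `i` and is absorbed by the normalisation by `opVal`. -/
theorem charPoly_eq (hp : 2 ≤ p) (h0 : a 0 ≠ 0) (j : ℕ) :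
    charPoly p n a j = charPolyAt p n a (-slope p n a j) := by
  have hp1 : (p : ℚ) - 1 ≠ 0 := by
    have : (2 : ℚ) ≤ p := by exact_mod_cast hp
    linarith
  set μ := slope p n a j
  have hg : ∀ i, gauge p (-((p : ℚ) - 1) * μ) a i =
      HahnSeries.single (-(((p : ℚ) ^ i - 1) * μ)) (1 : ℂ) * a i := by
    intro i
    rw [gauge]
    congr 2
    field_simp
  have hv : opVal n (gauge p (-((p : ℚ) - 1) * μ) a) = minHeight p n a (-μ) + μ := by
    obtain ⟨hle, i, hi, hne, he⟩ := opVal_spec n (b := gauge p (-((p : ℚ) - 1) * μ) a)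
      ⟨0, Nat.zero_le n, by rw [hg]; exact (single_mul_ne_zero _).2 h0⟩
    rw [hg, single_mul_ne_zero] at hne
    rw [he, hg, order_single_mul hne]
    have hmin : IsMinIndex p n a (-μ) i := by
      refine ⟨hi, hne, fun l hl hal => ?_⟩
      have := hle l hl (by rw [hg]; exact (single_mul_ne_zero _).2 hal)
      rw [he, hg, hg, order_single_mul hne, order_single_mul hal] at this
      rw [height, height]
      linarith
    rw [← hmin.height_eq, height]
    ring
  rw [charPoly, charPolyAt]
  refine Finset.sum_congr rfl fun i _ => ?_
  rw [hg, hv, ← mul_assoc, HahnSeries.single_mul_single, HahnSeries.coeff_single_mul, mul_one,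
    one_mul]
  congr 2
  ring

end Heights

/-! ### Vertices, edges and slopes of the Newton polygon. -/

section Polygon

variable {p n : ℕ} {a : ℕ → Hahn ℂ}

/-- The point `(p ^ i, val a_i)` lies strictly below the chords between points on either side. -/
def BelowChords (p n : ℕ) (a : ℕ → Hahn ℂ) (i : ℕ) : Prop :=
  i ≤ n ∧ a i ≠ 0 ∧ ∀ l r, l < i → i < r → r ≤ n → a l ≠ 0 → a r ≠ 0 →
    ((p : ℚ) ^ r - (p : ℚ) ^ l) * (a i).order <
      ((p : ℚ) ^ r - (p : ℚ) ^ i) * (a l).order + ((p : ℚ) ^ i - (p : ℚ) ^ l) * (a r).order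

theorem pow_strictMono_rat (hp : 2 ≤ p) : StrictMono fun i : ℕ => (p : ℚ) ^ i :=
  pow_right_strictMono₀ (by exact_mod_cast (by omega : 1 < p))

theorem BelowChords.height_lt {i l r : ℕ} (hi : BelowChords p n a i) (γ : ℚ) (hl : l < i)
    (hr : i < r) (hrn : r ≤ n) (hal : a l ≠ 0) (har : a r ≠ 0) :
    ((p : ℚ) ^ r - (p : ℚ) ^ l) * height p a γ i <
      ((p : ℚ) ^ r - (p : ℚ) ^ i) * height p a γ l +
        ((p : ℚ) ^ i - (p : ℚ) ^ l) * height p a γ r := by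
  have := hi.2.2 l r hl hr hrn hal har
  simp only [height]
  linarith

theorem vertex_mem_newtonPolygon {i : ℕ} (hi : i ≤ n) (hai : a i ≠ 0) {t : ℝ} (ht : 0 ≤ t) :
    ((p : ℝ) ^ i, ((a i).order : ℝ) + t) ∈ newtonPolygon p n a :=
  subset_convexHull ℝ _ ⟨i, hi, hai, rfl, by simpa using ht⟩

/-- If the point lay on or above a chord, raising both ends of the chord by the excess `t` would put
it in the interior of a segment of the polygon. -/
theorem IsVertex.belowChords (hp : 2 ≤ p) {i : ℕ} (h : IsVertex p n a i) :
    BelowChords p n a i := by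
  refine ⟨h.1, h.2.1, fun l r hl hr hrn hal har => ?_⟩
  by_contra hle
  have hmono : StrictMono fun i : ℕ => (p : ℝ) ^ i :=
    pow_right_strictMono₀ (by exact_mod_cast (by omega : 1 < p))
  have hli : (0 : ℝ) < (p : ℝ) ^ i - (p : ℝ) ^ l := sub_pos.2 (hmono hl)
  have hir : (0 : ℝ) < (p : ℝ) ^ r - (p : ℝ) ^ i := sub_pos.2 (hmono hr)
  have hlr : (0 : ℝ) < (p : ℝ) ^ r - (p : ℝ) ^ l := by linarith
  have hle' : ((p : ℝ) ^ r - (p : ℝ) ^ i) * (a l).order + ((p : ℝ) ^ i - (p : ℝ) ^ l) * (a r).order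
      ≤ ((p : ℝ) ^ r - (p : ℝ) ^ l) * (a i).order := by exact_mod_cast not_lt.1 hle
  set t : ℝ := (a i).order - (((p : ℝ) ^ r - (p : ℝ) ^ i) * (a l).order +
    ((p : ℝ) ^ i - (p : ℝ) ^ l) * (a r).order) / ((p : ℝ) ^ r - (p : ℝ) ^ l) with ht
  have ht0 : 0 ≤ t := by
    rw [ht, sub_nonneg, div_le_iff₀ hlr]
    linarith
  have := (mem_extremePoints_iff_left.1 h.2.2).2 _
    (vertex_mem_newtonPolygon (p := p) (hl.le.trans h.1) hal ht0) _
    (vertex_mem_newtonPolygon hrn har ht0)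
    ⟨((p : ℝ) ^ r - (p : ℝ) ^ i) / ((p : ℝ) ^ r - (p : ℝ) ^ l),
      ((p : ℝ) ^ i - (p : ℝ) ^ l) / ((p : ℝ) ^ r - (p : ℝ) ^ l), div_pos hir hlr,
      div_pos hli hlr, by field_simp; ring, ?_⟩
  · exact (hmono hl).ne (congrArg Prod.fst this)
  · simp only [Prod.smul_mk, Prod.mk_add_mk, smul_eq_mul, Prod.mk.injEq]
    constructor
    · field_simp
      ring
    · rw [ht]
      field_simp
      ring

/-- Every slope from a point on the left is smaller than every slope to a point on the right; any
`s` in between is the slope of a line touching the configuration only at `i`. -/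
theorem BelowChords.exists_support (hp : 2 ≤ p) {i : ℕ} (h : BelowChords p n a i) :
    ∃ s : ℚ, ∀ l ≤ n, a l ≠ 0 → l ≠ i →
      (a i).order - s * (p : ℚ) ^ i < (a l).order - s * (p : ℚ) ^ l := by
  classical
  have hmono := pow_strictMono_rat hp
  let S := (Finset.range (n + 1)).filter (a · ≠ 0)
  let m : ℕ → ℚ := fun l => ((a i).order - (a l).order) / ((p : ℚ) ^ i - (p : ℚ) ^ l)
  obtain ⟨s, hlo, hhi⟩ := Order.exists_between_finsets ((S.filter (· < i)).image m)
    ((S.filter (i < ·)).image m) (by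
      intro x hx y hy
      simp only [S, Finset.mem_image, Finset.mem_filter, Finset.mem_range,
        Nat.lt_succ_iff] at hx hy
      obtain ⟨l, ⟨⟨hln, hal⟩, hl⟩, rfl⟩ := hx
      obtain ⟨r, ⟨⟨hrn, har⟩, hr⟩, rfl⟩ := hy
      have h1 : (0 : ℚ) < (p : ℚ) ^ i - (p : ℚ) ^ l := sub_pos.2 (hmono hl)
      have h2 : (0 : ℚ) < (p : ℚ) ^ r - (p : ℚ) ^ i := sub_pos.2 (hmono hr)
      have := h.2.2 l r hl hr hrn hal har
      simp only [m]
      rw [← neg_div_neg_eq ((a i).order - (a r).order), div_lt_div_iff₀ h1 (by linarith)]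
      linarith)
  refine ⟨s, fun l hl hal hne => ?_⟩
  rcases hne.lt_or_gt with hlt | hgt
  · have h1 : (0 : ℚ) < (p : ℚ) ^ i - (p : ℚ) ^ l := sub_pos.2 (hmono hlt)
    have := hlo (m l) (Finset.mem_image_of_mem _ (by simp [S, hal, hlt]; omega))
    simp only [m] at this
    rw [div_lt_iff₀ h1] at this
    linarith
  · have h2 : (0 : ℚ) < (p : ℚ) ^ l - (p : ℚ) ^ i := sub_pos.2 (hmono hgt)
    have := hhi (m l) (Finset.mem_image_of_mem _ (by simp [S, hal, hgt]; omega))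
    simp only [m] at this
    rw [← neg_div_neg_eq, lt_div_iff₀ (by linarith)] at this
    linarith

theorem BelowChords.isVertex (hp : 2 ≤ p) {i : ℕ} (h : BelowChords p n a i) :
    IsVertex p n a i := by
  obtain ⟨s, hs⟩ := h.exists_support hp
  refine ⟨h.1, h.2.1, ?_⟩
  set P : ℝ × ℝ := ((p : ℝ) ^ i, ((a i).order : ℝ)) with hP
  have hPmem : P ∈ newtonPolygon p n a := by
    simpa using vertex_mem_newtonPolygon (p := p) h.1 h.2.1 le_rfl
  -- A point together with an open half-plane having that point on its boundary line is convex, so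
  -- it suffices to check the generating half-lines.
  have hsub : newtonPolygon p n a ⊆
      {q | q = P ∨ P.2 - (s : ℝ) * P.1 < q.2 - (s : ℝ) * q.1} := by
    refine convexHull_min ?_ (convex_iff_forall_pos.2 ?_)
    · rintro q ⟨l, hl, hal, h1, h2⟩
      by_cases hne : l = i
      · subst hne
        rcases h2.eq_or_lt with he | hlt
        · exact Or.inl (Prod.ext h1 he.symm)
        · refine Or.inr ?_
          rw [h1, hP]
          simpa using hlt
      · refine Or.inr ?_
        have : ((a i).order : ℝ) - s * (p : ℝ) ^ i < (a l).order - s * (p : ℝ) ^ l := by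
          exact_mod_cast hs l hl hal hne
        rw [h1, hP]
        exact this.trans_le (by linarith)
    · intro x hx y hy u v hu hv huv
      have hv' : v = 1 - u := by linarith
      rcases hx with rfl | hx <;> rcases hy with hy | hy
      · exact Or.inl (by rw [hy, ← add_smul, huv, one_smul])
      all_goals
        refine Or.inr ?_
        simp only [Prod.fst_add, Prod.snd_add, Prod.smul_fst, Prod.smul_snd, smul_eq_mul]
      · have := mul_lt_mul_of_pos_left hy hv
        subst hv'
        linarith
      · have := mul_lt_mul_of_pos_left hx hu
        rw [hy]
        subst hv'
        linarith
      · have h1 := mul_lt_mul_of_pos_left hx hu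
        have h2 := mul_lt_mul_of_pos_left hy hv
        subst hv'
        linarith
  refine mem_extremePoints_iff_left.2 ⟨hPmem, fun x hx y hy hxy => ?_⟩
  obtain ⟨u, v, hu, hv, huv, he⟩ := hxy
  rcases hsub hx with hx | hx
  · exact hx
  exfalso
  have hy' : P.2 - (s : ℝ) * P.1 ≤ y.2 - (s : ℝ) * y.1 := by
    rcases hsub hy with hy | hy
    · rw [hy]
    · exact hy.le
  have h1 := mul_lt_mul_of_pos_left hx hu
  have h2 := mul_le_mul_of_nonneg_left hy' hv.le
  have e1 : u * x.1 + v * y.1 = P.1 := congrArg Prod.fst he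
  have e2 : u * x.2 + v * y.2 = P.2 := congrArg Prod.snd he
  have : u * (P.2 - s * P.1) + v * (P.2 - s * P.1) = P.2 - s * P.1 := by
    rw [← add_mul, huv, one_mul]
  have e3 : s * P.1 = u * (s * x.1) + v * (s * y.1) := by rw [← e1]; ring
  linarith

theorem exists_first_last_isMinIndex (h0 : a 0 ≠ 0) (γ : ℚ) :
    ∃ F G, IsMinIndex p n a γ F ∧ IsMinIndex p n a γ G ∧
      ∀ i, IsMinIndex p n a γ i → F ≤ i ∧ i ≤ G := by
  classical
  obtain ⟨i₀, hi₀⟩ := exists_isMinIndex (p := p) (n := n) h0 γ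
  have hex : ∃ i, IsMinIndex p n a γ i := ⟨i₀, hi₀⟩
  exact ⟨Nat.find hex, Nat.findGreatest (IsMinIndex p n a γ) n, Nat.find_spec hex,
    Nat.findGreatest_spec hi₀.1 hi₀,
    fun i hi => ⟨Nat.find_min' hex hi, Nat.le_findGreatest hi.1 hi⟩⟩

theorem IsMinIndex.height_lt {γ : ℚ} {i l : ℕ} (hi : IsMinIndex p n a γ i) (hl : l ≤ n)
    (hal : a l ≠ 0) (h : ¬ IsMinIndex p n a γ l) : height p a γ i < height p a γ l := by
  by_contra hle
  exact h ⟨hl, hal, fun m hm ham => (not_lt.1 hle).trans (hi.2.2 m hm ham)⟩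

theorem IsMinIndex.belowChords_of_first (hp : 2 ≤ p) {γ : ℚ} {F : ℕ}
    (hF : IsMinIndex p n a γ F) (h : ∀ i, IsMinIndex p n a γ i → F ≤ i) :
    BelowChords p n a F := by
  refine ⟨hF.1, hF.2.1, fun l r hl hr hrn hal har => ?_⟩
  have h1 := hF.height_lt (hl.le.trans hF.1) hal fun hm => absurd (h l hm) (not_le.2 hl)
  have h2 := hF.2.2 r hrn har
  have h3 := mul_pos (sub_pos.2 (pow_strictMono_rat hp hr)) (sub_pos.2 h1)
  have h4 := mul_nonneg (sub_pos.2 (pow_strictMono_rat hp hl)).le (sub_nonneg.2 h2)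
  simp only [height] at h3 h4
  linarith

theorem IsMinIndex.belowChords_of_last (hp : 2 ≤ p) {γ : ℚ} {G : ℕ}
    (hG : IsMinIndex p n a γ G) (h : ∀ i, IsMinIndex p n a γ i → i ≤ G) :
    BelowChords p n a G := by
  refine ⟨hG.1, hG.2.1, fun l r hl hr hrn hal har => ?_⟩
  have h1 := hG.height_lt hrn har fun hm => absurd (h r hm) (not_le.2 hr)
  have h2 := hG.2.2 l (hl.le.trans hG.1) hal
  have h3 := mul_nonneg (sub_pos.2 (pow_strictMono_rat hp hr)).le (sub_nonneg.2 h2)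
  have h4 := mul_pos (sub_pos.2 (pow_strictMono_rat hp hl)) (sub_pos.2 h1)
  simp only [height] at h3 h4
  linarith

variable (p n a) in
theorem finite_isVertex : (Set.ofPred (IsVertex p n a)).Finite :=
  (Set.finite_Iic n).subset fun _ hi => hi.1

theorem isVertex_zero (hp : 2 ≤ p) (h0 : a 0 ≠ 0) : IsVertex p n a 0 :=
  BelowChords.isVertex hp ⟨Nat.zero_le n, h0, fun _ _ hl => absurd hl (Nat.not_lt_zero _)⟩

theorem alpha_zero (hp : 2 ≤ p) (h0 : a 0 ≠ 0) : alpha p n a 0 = 0 :=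
  Nat.nth_zero_of_zero (isVertex_zero hp h0)

/-- The truncated subtraction in `numSlopes` loses nothing, because the index `0` is always a
vertex. -/
theorem card_isVertex (hp : 2 ≤ p) (h0 : a 0 ≠ 0) :
    (finite_isVertex p n a).toFinset.card = numSlopes p n a + 1 := by
  have h1 : (Set.ofPred (IsVertex p n a)).ncard = (finite_isVertex p n a).toFinset.card :=
    Set.ncard_eq_toFinset_card _ _
  have h2 : 0 < (finite_isVertex p n a).toFinset.card :=
    Finset.card_pos.2 ⟨0, (finite_isVertex p n a).mem_toFinset.2 (isVertex_zero hp h0)⟩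
  have h3 : numSlopes p n a = (Set.ofPred (IsVertex p n a)).ncard - 1 := rfl
  omega

theorem isVertex_alpha (hp : 2 ≤ p) (h0 : a 0 ≠ 0) {j : ℕ} (hj : j ≤ numSlopes p n a) :
    IsVertex p n a (alpha p n a j) :=
  Nat.nth_mem_of_lt_card (finite_isVertex p n a) (by rw [card_isVertex hp h0]; omega)

theorem alpha_lt (hp : 2 ≤ p) (h0 : a 0 ≠ 0) {i j : ℕ} (hij : i < j)
    (hj : j ≤ numSlopes p n a) : alpha p n a i < alpha p n a j :=
  Nat.nth_lt_nth' hij fun _ => by rw [card_isVertex hp h0]; omega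

theorem alpha_le (hp : 2 ≤ p) (h0 : a 0 ≠ 0) {i j : ℕ} (hij : i ≤ j)
    (hj : j ≤ numSlopes p n a) : alpha p n a i ≤ alpha p n a j := by
  rcases hij.lt_or_eq with h | rfl
  · exact (alpha_lt hp h0 h hj).le
  · exact le_rfl

theorem IsVertex.exists_alpha_eq (hp : 2 ≤ p) (h0 : a 0 ≠ 0) {x : ℕ} (hx : IsVertex p n a x) :
    ∃ i ≤ numSlopes p n a, alpha p n a i = x := by
  obtain ⟨i, hi, he⟩ := Nat.exists_lt_card_finite_nth_eq (finite_isVertex p n a) hx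
  rw [card_isVertex hp h0] at hi
  exact ⟨i, by omega, he⟩

theorem slope_mul (hp : 2 ≤ p) (h0 : a 0 ≠ 0) {j : ℕ} (hj : j ∈ Finset.Icc 1 (numSlopes p n a)) :
    slope p n a j * ((p : ℚ) ^ alpha p n a j - (p : ℚ) ^ alpha p n a (j - 1)) =
      (a (alpha p n a j)).order - (a (alpha p n a (j - 1))).order := by
  rw [Finset.mem_Icc] at hj
  refine div_mul_cancel₀ _ (sub_pos.2 (pow_strictMono_rat hp (alpha_lt hp h0 ?_ hj.2))).ne'
  omega

theorem height_alpha_eq (hp : 2 ≤ p) (h0 : a 0 ≠ 0) {j : ℕ}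
    (hj : j ∈ Finset.Icc 1 (numSlopes p n a)) :
    height p a (-slope p n a j) (alpha p n a (j - 1)) =
      height p a (-slope p n a j) (alpha p n a j) := by
  have := slope_mul hp h0 hj
  simp only [height]
  linarith

/-- The first and last minimising indices are vertices, and no vertex lies strictly between the ends
of the edge. A vertex beyond one end is strictly higher, by the chord inequality at that end, so
both indices are ends; the two ends have equal height. -/
theorem isMinIndex_edge (hp : 2 ≤ p) (h0 : a 0 ≠ 0) {j : ℕ}
    (hj : j ∈ Finset.Icc 1 (numSlopes p n a)) :
    IsMinIndex p n a (-slope p n a j) (alpha p n a (j - 1)) ∧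
      IsMinIndex p n a (-slope p n a j) (alpha p n a j) ∧
      ∀ i, IsMinIndex p n a (-slope p n a j) i →
        alpha p n a (j - 1) ≤ i ∧ i ≤ alpha p n a j := by
  have hj' := Finset.mem_Icc.1 hj
  have he := height_alpha_eq hp h0 hj
  have huw := alpha_lt hp h0 (show j - 1 < j by omega) hj'.2
  have hu := (isVertex_alpha hp h0 (show j - 1 ≤ numSlopes p n a by omega)).belowChords hp
  have hw := (isVertex_alpha hp h0 hj'.2).belowChords hp
  have hgap : ∀ x, IsVertex p n a x → x ≤ alpha p n a (j - 1) ∨ alpha p n a j ≤ x := by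
    intro x hx
    obtain ⟨i, hi, rfl⟩ := hx.exists_alpha_eq hp h0
    by_cases h : i ≤ j - 1
    · exact Or.inl (alpha_le hp h0 h (by omega))
    · exact Or.inr (alpha_le hp h0 (by omega) hi)
  obtain ⟨F, G, hF, hG, hFG⟩ := exists_first_last_isMinIndex (p := p) (n := n) h0 (-slope p n a j)
  generalize alpha p n a (j - 1) = u at *
  generalize alpha p n a j = w at *
  generalize -slope p n a j = γ at *
  have hX := sub_pos.2 (pow_strictMono_rat hp huw)
  have key : ∀ x, IsMinIndex p n a γ x → BelowChords p n a x → x = u ∨ x = w := by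
    intro x hx hxc
    rcases hgap x (hxc.isVertex hp) with h | h
    · rcases h.lt_or_eq with h | h
      · have h1 := hu.height_lt γ h huw hw.1 hx.2.1 hw.2.1
        have h2 := mul_nonneg hX.le (sub_nonneg.2 (hx.2.2 u hu.1 hu.2.1))
        rw [← he] at h1
        linarith
      · exact Or.inl h
    · rcases h.lt_or_eq with h | h
      · have h1 := hw.height_lt γ huw h hx.1 hu.2.1 hx.2.1
        have h2 := mul_nonneg hX.le (sub_nonneg.2 (hx.2.2 w hw.1 hw.2.1))
        rw [he] at h1
        linarith
      · exact Or.inr h.symm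
  have hF' := key F hF (hF.belowChords_of_first hp fun i hi => (hFG i hi).1)
  have hG' := key G hG (hG.belowChords_of_last hp fun i hi => (hFG i hi).2)
  have hmin : height p a γ u = minHeight p n a γ := by
    rcases hF' with rfl | rfl
    · exact hF.height_eq
    · rw [he, hF.height_eq]
  have hmu := isMinIndex_of_height_eq hu.1 hu.2.1 hmin
  have hmw := isMinIndex_of_height_eq hw.1 hw.2.1 (he ▸ hmin)
  refine ⟨hmu, hmw, fun i hi => ⟨?_, ?_⟩⟩
  · have := (hFG u hmu).1
    have := (hFG i hi).1
    omega
  · have := (hFG w hmw).2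
    have := (hFG i hi).2
    omega

theorem slope_lt_succ (hp : 2 ≤ p) (h0 : a 0 ≠ 0) {j : ℕ} (hj : 1 ≤ j)
    (hj' : j + 1 ≤ numSlopes p n a) : slope p n a j < slope p n a (j + 1) := by
  have hm := slope_mul (n := n) hp h0 (Finset.mem_Icc.2 ⟨hj, by omega⟩)
  have hm' := slope_mul (n := n) hp h0 (Finset.mem_Icc.2 ⟨by omega, hj'⟩)
  rw [Nat.add_sub_cancel] at hm'
  have h1 := alpha_lt hp h0 (show j - 1 < j by omega) (show j ≤ numSlopes p n a by omega)
  have h2 := alpha_lt hp h0 (Nat.lt_succ_self j) hj'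
  have hw := (isVertex_alpha hp h0 (show j ≤ numSlopes p n a by omega)).belowChords hp
  have hz := isVertex_alpha hp h0 hj'
  have hu := isVertex_alpha hp h0 (show j - 1 ≤ numSlopes p n a by omega)
  have h3 := hw.2.2 _ _ h1 h2 hz.1 hu.2.1 hz.2.1
  have hX := sub_pos.2 (pow_strictMono_rat hp h1)
  have hX' := sub_pos.2 (pow_strictMono_rat hp h2)
  have h4 : ((p : ℚ) ^ alpha p n a (j + 1) - (p : ℚ) ^ alpha p n a j) *
      ((a (alpha p n a j)).order - (a (alpha p n a (j - 1))).order) <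
      ((p : ℚ) ^ alpha p n a j - (p : ℚ) ^ alpha p n a (j - 1)) *
      ((a (alpha p n a (j + 1))).order - (a (alpha p n a j)).order) := by linarith
  rw [← hm, ← hm'] at h4
  refine lt_of_mul_lt_mul_left ?_ (mul_pos hX hX').le
  linarith

theorem slope_lt (hp : 2 ≤ p) (h0 : a 0 ≠ 0) {i j : ℕ} (hi : 1 ≤ i) (hij : i < j)
    (hj : j ≤ numSlopes p n a) : slope p n a i < slope p n a j := by
  induction j, hij using Nat.le_induction with
  | base => exact slope_lt_succ hp h0 hi hj
  | succ j hij ih => exact (ih (by omega)).trans (slope_lt_succ hp h0 (by omega) hj)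

/-- The first and last minimising indices are distinct vertices of equal height. A vertex between
them would be strictly lower, so they are consecutive and span an edge. -/
theorem exists_slope_eq (hp : 2 ≤ p) (h0 : a 0 ≠ 0) {γ : ℚ} {l r : ℕ} (hlr : l < r)
    (hl : IsMinIndex p n a γ l) (hr : IsMinIndex p n a γ r) :
    ∃ j ∈ Finset.Icc 1 (numSlopes p n a), γ = -slope p n a j := by
  obtain ⟨F, G, hF, hG, hFG⟩ := exists_first_last_isMinIndex (p := p) (n := n) h0 γ
  have hlt : F < G := by
    have := (hFG l hl).1
    have := (hFG r hr).2
    omega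
  obtain ⟨i, hi, hiF⟩ := ((hF.belowChords_of_first hp fun i hi => (hFG i hi).1).isVertex
    hp).exists_alpha_eq hp h0
  obtain ⟨k, hk, hkG⟩ := ((hG.belowChords_of_last hp fun i hi => (hFG i hi).2).isVertex
    hp).exists_alpha_eq hp h0
  have hik : i < k := by
    by_contra h
    have := alpha_le hp h0 (not_lt.1 h) hi
    omega
  have hFG' : height p a γ F = height p a γ G := hF.height_eq.trans hG.height_eq.symm
  have hki : k = i + 1 := by
    by_contra hne
    have h1 := alpha_lt hp h0 (Nat.lt_succ_self i) (show i + 1 ≤ numSlopes p n a by omega)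
    have h2 := alpha_lt hp h0 (show i + 1 < k by omega) hk
    have hx := (isVertex_alpha hp h0 (show i + 1 ≤ numSlopes p n a by omega)).belowChords hp
    rw [hiF] at h1
    rw [hkG] at h2
    have h3 := hx.height_lt γ h1 h2 hG.1 hF.2.1 hG.2.1
    have h4 := mul_nonneg (sub_pos.2 (pow_strictMono_rat hp hlt)).le
      (sub_nonneg.2 (hF.2.2 _ hx.1 hx.2.1))
    rw [← hFG'] at h3
    linarith
  subst hki
  refine ⟨i + 1, Finset.mem_Icc.2 ⟨by omega, hk⟩, ?_⟩
  have hX := sub_pos.2 (pow_strictMono_rat hp hlt)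
  rw [slope, Nat.add_sub_cancel, hiF, hkG, ← neg_div, eq_div_iff hX.ne']
  simp only [height] at hFG'
  linarith

theorem slopeMultSum_eq (hp : 2 ≤ p) (h0 : a 0 ≠ 0) {j : ℕ} (hj : 1 ≤ j)
    (hj' : j ≤ numSlopes p n a) : slopeMultSum p n a j = alpha p n a (j - 1) := by
  induction j, hj using Nat.le_induction with
  | base => simp [slopeMultSum, alpha_zero hp h0]
  | succ j hj ih =>
    have h1 := ih (by omega)
    rw [slopeMultSum] at h1 ⊢
    rw [Finset.sum_Ico_succ_top hj, h1, slopeMult, Nat.add_sub_cancel]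
    have := alpha_lt hp h0 (show j - 1 < j by omega) (show j ≤ numSlopes p n a by omega)
    omega

/-- The vertex `α_j` is common to the edges `j` and `j + 1`. Moving from `-μ_j` to `-μ_{j+1}` lowers
its height by `p ^ α_j (μ_{j+1} - μ_j)`, which is the new term of `ν_{j+1} / (p - 1)`. -/
theorem order_sub_nu (hp : 2 ≤ p) (h0 : a 0 ≠ 0) {j : ℕ} (hj : 1 ≤ j)
    (hj' : j ≤ numSlopes p n a) :
    (a 0).order - nu p n a j / ((p : ℚ) - 1) =
      height p a (-slope p n a j) (alpha p n a (j - 1)) := by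
  have hp1 : (p : ℚ) - 1 ≠ 0 := by
    have : (2 : ℚ) ≤ p := by exact_mod_cast hp
    linarith
  rw [nu, mul_div_cancel_left₀ _ hp1]
  induction j, hj using Nat.le_induction with
  | base => simp [alpha_zero hp h0, height, sub_eq_add_neg]
  | succ j hj ih =>
    have h1 := ih (by omega)
    have h2 := slope_mul (n := n) hp h0 (Finset.mem_Icc.2 ⟨hj, by omega⟩)
    rw [Finset.sum_Icc_succ_top (by omega), slopeMultSum_eq hp h0 (by omega) hj']
    simp only [Nat.add_sub_cancel, height] at h1 ⊢
    linarith

theorem order_sub_nu_eq_minHeight (hp : 2 ≤ p) (h0 : a 0 ≠ 0) {j : ℕ}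
    (hj : j ∈ Finset.Icc 1 (numSlopes p n a)) :
    (a 0).order - nu p n a j / ((p : ℚ) - 1) = minHeight p n a (-slope p n a j) := by
  have hj' := Finset.mem_Icc.1 hj
  rw [order_sub_nu hp h0 hj'.1 hj'.2, (isMinIndex_edge hp h0 hj).1.height_eq]

end Polygon

/-! ### Roots of the polynomials `χ_γ`. -/

section CharacteristicPolynomials

variable {p n : ℕ} {a : ℕ → Hahn ℂ}

/-- The characteristic polynomial at the slope `μ_j` is a power of `X` times a polynomial whose
roots are the exponents. -/
theorem exists_charPoly_eq (hp : 2 ≤ p) (h0 : a 0 ≠ 0) {j : ℕ}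
    (hj : j ∈ Finset.Icc 1 (numSlopes p n a)) :
    charPolyAt p n a (-slope p n a j) = Polynomial.X ^ alpha p n a (j - 1) *
        (Polynomial.C (a (alpha p n a j)).leadingCoeff *
          ((exponents p n a j).map fun d => Polynomial.X - Polynomial.C d).prod) ∧
      (a (alpha p n a j)).leadingCoeff * ((exponents p n a j).map fun d => -d).prod =
        (a (alpha p n a (j - 1))).leadingCoeff := by
  obtain ⟨hu, hw, huw⟩ := isMinIndex_edge hp h0 hj
  have hχ := charPolyAt_ne_zero (p := p) (n := n) h0 (-slope p n a j)
  obtain ⟨Q, hQ⟩ : Polynomial.X ^ alpha p n a (j - 1) ∣ charPolyAt p n a (-slope p n a j) := by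
    rw [Polynomial.X_pow_dvd_iff]
    intro d hd
    by_contra hne
    exact absurd (huw d (coeff_charPolyAt_ne_zero.1 hne)).1 (not_le.2 hd)
  have hQ0 : Q ≠ 0 := by
    rintro rfl
    exact hχ (by rw [hQ, mul_zero])
  have hQc : Q.coeff 0 = (a (alpha p n a (j - 1))).leadingCoeff := by
    rw [← hu.coeff_charPolyAt, hQ, Polynomial.coeff_X_pow_mul', if_pos le_rfl, Nat.sub_self]
  have hdeg : (charPolyAt p n a (-slope p n a j)).natDegree = alpha p n a j := by
    refine le_antisymm (Polynomial.natDegree_le_iff_coeff_eq_zero.2 fun d hd => ?_)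
      (Polynomial.le_natDegree_of_ne_zero (coeff_charPolyAt_ne_zero.2 hw))
    by_contra hne
    exact absurd (huw d (coeff_charPolyAt_ne_zero.1 hne)).2 (not_le.2 hd)
  have hQl : Q.leadingCoeff = (a (alpha p n a j)).leadingCoeff := by
    have : (charPolyAt p n a (-slope p n a j)).leadingCoeff = Q.leadingCoeff := by
      rw [hQ, Polynomial.leadingCoeff_mul, Polynomial.leadingCoeff_X_pow, one_mul]
    rw [← this, Polynomial.leadingCoeff, hdeg, hw.coeff_charPolyAt]
  -- The factor `X ^ α_{j-1}` only contributes the root `0`, and `Q` has nonzero constant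
  -- coefficient, so discarding zero leaves the roots of `Q`.
  have hroots : exponents p n a j = Q.roots := by
    rw [exponents, charPoly_eq hp h0, hQ, Polynomial.roots_mul (hQ ▸ hχ), Polynomial.roots_X_pow,
      Multiset.filter_add, Multiset.filter_eq_nil.2, zero_add, Multiset.filter_eq_self]
    · rintro d hd rfl
      rw [Polynomial.mem_roots hQ0, Polynomial.IsRoot, ← Polynomial.coeff_zero_eq_eval_zero,
        hQc] at hd
      exact HahnSeries.leadingCoeff_ne_zero.2 hu.2.1 hd
    · intro d hd
      rw [Multiset.mem_of_mem_nsmul hd |> Multiset.mem_singleton.1]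
      simp
  have hsplit := (IsAlgClosed.splits Q).eq_prod_roots
  rw [hQl, ← hroots] at hsplit
  refine ⟨by rw [hQ, ← hsplit], ?_⟩
  rw [← hQc, Polynomial.coeff_zero_eq_eval_zero, hsplit, Polynomial.eval_mul, Polynomial.eval_C,
    Polynomial.eval_multiset_prod, Multiset.map_map]
  simp

/-- Along each edge, `∏ (-c_{i,l})` is the ratio of the leading coefficients at its two ends; the
ratios telescope. -/
theorem prod_neg_exponents (hp : 2 ≤ p) (h0 : a 0 ≠ 0) {j : ℕ} (hj : j ≤ numSlopes p n a) :
    (a (alpha p n a j)).leadingCoeff *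
      ∏ i ∈ Finset.Icc 1 j, ((exponents p n a i).map fun d => -d).prod = (a 0).leadingCoeff := by
  induction j with
  | zero => simp [alpha_zero hp h0]
  | succ j ih =>
    rw [Finset.prod_Icc_succ_top (by omega), mul_left_comm,
      (exists_charPoly_eq hp h0 (Finset.mem_Icc.2 ⟨by omega, hj⟩)).2, Nat.add_sub_cancel, mul_comm,
      ih (by omega)]

theorem expMult_eq_rootMultiplicity (hp : 2 ≤ p) (h0 : a 0 ≠ 0) {c : ℂ} (hc : c ≠ 0) (j : ℕ) :
    expMult p n a c j = (charPolyAt p n a (-slope p n a j)).rootMultiplicity c := by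
  classical
  rw [expMult, exponents, charPoly_eq hp h0]
  convert Multiset.count_filter_of_pos (p := fun d : ℂ => d ≠ 0) hc using 1
  rw [Polynomial.count_roots]

/-- Off the slopes a single index attains the minimum, so `χ_γ` is a monomial. -/
theorem eval_charPolyAt_ne_zero (hp : 2 ≤ p) (h0 : a 0 ≠ 0) {c : ℂ} (hc : c ≠ 0) {γ : ℚ}
    (hγ : ∀ j ∈ Finset.Icc 1 (numSlopes p n a), γ ≠ -slope p n a j) :
    (charPolyAt p n a γ).eval c ≠ 0 := by
  obtain ⟨i, hi⟩ := exists_isMinIndex (p := p) (n := n) h0 γ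
  have huniq : ∀ l, l ≠ i → (charPolyAt p n a γ).coeff l = 0 := by
    intro l hl
    by_contra hne
    have hl' := coeff_charPolyAt_ne_zero.1 hne
    obtain ⟨j, hj, he⟩ : ∃ j ∈ Finset.Icc 1 (numSlopes p n a), γ = -slope p n a j := by
      rcases hl.lt_or_gt with h | h
      · exact exists_slope_eq hp h0 h hl' hi
      · exact exists_slope_eq hp h0 h hi hl'
    exact hγ j hj he
  have : charPolyAt p n a γ = Polynomial.monomial i ((charPolyAt p n a γ).coeff i) := by
    ext l
    rw [Polynomial.coeff_monomial]
    split_ifs with h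
    · rw [h]
    · exact huniq l (Ne.symm h)
  rw [this, Polynomial.eval_monomial]
  exact mul_ne_zero (coeff_charPolyAt_ne_zero.2 hi) (pow_ne_zero _ hc)

end CharacteristicPolynomials

/-! ### Order of vanishing at `c` and its loss under division by `χ_γ`. -/

section Poles

variable {c : ℂ} {f g : RatLam}

theorem noPoleAt_iff :
    NoPoleAt f c ↔ ∃ P Q : Polynomial ℂ, Q.eval c ≠ 0 ∧
      f = algebraMap _ RatLam P / algebraMap _ RatLam Q := by
  refine ⟨fun h => ⟨f.num, f.denom, h, (RatFunc.num_div_denom f).symm⟩, ?_⟩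
  rintro ⟨P, Q, hQ, rfl⟩ h
  obtain ⟨R, hR⟩ := RatFunc.denom_div_dvd P Q
  exact hQ (by rw [hR, Polynomial.eval_mul, h, zero_mul])

theorem NoPoleAt.mul (hf : NoPoleAt f c) (hg : NoPoleAt g c) : NoPoleAt (f * g) c := by
  obtain ⟨R, hR⟩ := RatFunc.denom_mul_dvd f g
  intro h
  refine mul_ne_zero hf hg ?_
  rw [← Polynomial.eval_mul, hR, Polynomial.eval_mul, h, zero_mul]

theorem NoPoleAt.add (hf : NoPoleAt f c) (hg : NoPoleAt g c) : NoPoleAt (f + g) c := by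
  obtain ⟨R, hR⟩ := RatFunc.denom_add_dvd f g
  intro h
  refine mul_ne_zero hf hg ?_
  rw [← Polynomial.eval_mul, hR, Polynomial.eval_mul, h, zero_mul]

theorem noPoleAt_algebraMap (P : Polynomial ℂ) : NoPoleAt (algebraMap _ RatLam P) c := by
  rw [NoPoleAt, RatFunc.denom_algebraMap, Polynomial.eval_one]
  exact one_ne_zero

variable (c) in
/-- The rational functions that vanish at `c` to order at least `k`. -/
noncomputable def vanishingOrderGE (k : ℕ) : AddSubgroup RatLam where
  carrier := {f | ∃ u, NoPoleAt u c ∧ f = (RatFunc.X - RatFunc.C c) ^ k * u}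
  zero_mem' := ⟨0, by simpa using noPoleAt_algebraMap (c := c) 0, by simp⟩
  add_mem' := by
    rintro _ _ ⟨u, hu, rfl⟩ ⟨v, hv, rfl⟩
    exact ⟨u + v, hu.add hv, by ring⟩
  neg_mem' := by
    rintro _ ⟨u, hu, rfl⟩
    refine ⟨-u, ?_, by ring⟩
    simpa using (noPoleAt_algebraMap (c := c) (-1)).mul hu

theorem X_sub_C_eq (c : ℂ) : (RatFunc.X - RatFunc.C c : RatLam) =
    algebraMap _ RatLam (Polynomial.X - Polynomial.C c) := by
  rw [map_sub, RatFunc.algebraMap_X, RatFunc.algebraMap_C]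

theorem X_sub_C_ne_zero (c : ℂ) : (RatFunc.X - RatFunc.C c : RatLam) ≠ 0 := by
  rw [X_sub_C_eq]
  exact (map_ne_zero_iff _ (RatFunc.algebraMap_injective ℂ)).2 (Polynomial.X_sub_C_ne_zero c)

theorem mul_mem_vanishingOrderGE {k : ℕ} (hf : NoPoleAt f c) (hg : g ∈ vanishingOrderGE c k) :
    f * g ∈ vanishingOrderGE c k := by
  obtain ⟨u, hu, rfl⟩ := hg
  exact ⟨f * u, hf.mul hu, by ring⟩

theorem vanishingOrderGE_antitone {k l : ℕ} (h : k ≤ l) :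
    vanishingOrderGE c l ≤ vanishingOrderGE c k := by
  rintro _ ⟨u, hu, rfl⟩
  refine ⟨(RatFunc.X - RatFunc.C c) ^ (l - k) * u, ?_, ?_⟩
  · rw [X_sub_C_eq, ← map_pow]
    exact (noPoleAt_algebraMap _).mul hu
  · rw [← mul_assoc, ← pow_add, Nat.add_sub_cancel' h]

theorem noPoleAt_of_mem {k : ℕ} (h : f ∈ vanishingOrderGE c k) : NoPoleAt f c := by
  obtain ⟨u, hu, rfl⟩ := vanishingOrderGE_antitone (Nat.zero_le k) h
  simpa using hu

/-- Division by a polynomial lowers the order of vanishing by at most its root multiplicity. -/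
theorem mem_vanishingOrderGE_of_mul {k : ℕ} {P : Polynomial ℂ} (hP : P ≠ 0)
    (h : algebraMap _ RatLam P * f ∈ vanishingOrderGE c (k + P.rootMultiplicity c)) :
    f ∈ vanishingOrderGE c k := by
  obtain ⟨u, hu, he⟩ := h
  obtain ⟨Q, hQ, hdvd⟩ := Polynomial.exists_eq_pow_rootMultiplicity_mul_and_not_dvd P hP c
  have hQc : Q.eval c ≠ 0 := fun h => hdvd (Polynomial.dvd_iff_isRoot.2 h)
  have hQ0 : algebraMap _ RatLam Q ≠ 0 :=
    (map_ne_zero_iff _ (RatFunc.algebraMap_injective ℂ)).2 fun h => hQc (by simp [h])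
  have hinv : NoPoleAt (algebraMap _ RatLam Q)⁻¹ c :=
    noPoleAt_iff.2 ⟨1, Q, hQc, by rw [map_one, one_div]⟩
  refine ⟨(algebraMap _ RatLam Q)⁻¹ * u, hinv.mul hu, ?_⟩
  have hX := pow_ne_zero (P.rootMultiplicity c) (X_sub_C_ne_zero c)
  -- Rewriting with `hQ` also replaces `P` inside the multiplicity in the exponent; the final `← hQ`
  -- undoes that.
  rw [hQ, map_mul, map_pow, ← X_sub_C_eq, ← hQ] at he
  refine mul_left_cancel₀ (mul_ne_zero hX hQ0) (he.trans ?_)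
  rw [pow_add]
  field_simp

variable {p n : ℕ} {a : ℕ → Hahn ℂ}

theorem mahlerOp_coeff_mem (hp : 2 ≤ p) {k : ℕ} {F : Hahn RatLam}
    (hF : ∀ δ, F.coeff δ ∈ vanishingOrderGE c k) (δ : ℚ) :
    (mahlerOp p hp n a F).coeff δ ∈ vanishingOrderGE c k := by
  rw [mahlerOp_apply, HahnSeries.coeff_sum]
  refine sum_mem fun i _ => ?_
  rw [HahnSeries.coeff_mul]
  refine sum_mem fun x _ => mul_mem_vanishingOrderGE ?_ ?_
  · rw [toLam_coeff, ← RatFunc.algebraMap_C]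
    exact noPoleAt_algebraMap _
  · rw [HahnSeries.C_mul_eq_smul, HahnSeries.coeff_smul, coeff_phi_iterate, smul_eq_mul,
      ← RatFunc.algebraMap_X, ← map_pow]
    exact mul_mem_vanishingOrderGE (noPoleAt_algebraMap _) (hF _)

/-- One step of the recursion for the coefficients of a solution. -/
theorem coeff_mem_of_coeff_lt_mem (hp : 2 ≤ p) (h0 : a 0 ≠ 0) {k : ℕ} {F : Hahn RatLam} {γ : ℚ}
    (hM : (mahlerOp p hp n a F).coeff (minHeight p n a γ) ∈
      vanishingOrderGE c (k + (charPolyAt p n a γ).rootMultiplicity c))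
    (hF : ∀ δ < γ, F.coeff δ ∈
      vanishingOrderGE c (k + (charPolyAt p n a γ).rootMultiplicity c)) :
    F.coeff γ ∈ vanishingOrderGE c k := by
  refine mem_vanishingOrderGE_of_mul (charPolyAt_ne_zero (p := p) (n := n) h0 γ) ?_
  -- Removing the part of `F` below `γ` makes `coeff_lead` applicable: `χ_γ F_γ` is the coefficient
  -- of `M F` at `π γ` minus a contribution of the lower coefficients.
  have hlead := (mahlerOp_isTriangular (n := n) hp h0).coeff_lead (F - HahnSeries.truncLT γ F) γ
    fun δ hδ => by simp [HahnSeries.coeff_truncLT, hδ]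
  rw [HahnSeries.coeff_sub, HahnSeries.coeff_truncLT, if_neg (lt_irrefl γ), sub_zero, map_sub,
    HahnSeries.coeff_sub] at hlead
  rw [← hlead]
  refine sub_mem hM (mahlerOp_coeff_mem hp (fun δ => ?_) _)
  rw [HahnSeries.coeff_truncLT]
  split_ifs with h
  · exact hF δ h
  · exact zero_mem _

end Poles

/-! ### The solution `g`: valuation, poles, leading coefficient. -/

section Solutions

variable {p n : ℕ} {a : ℕ → Hahn ℂ} {j : ℕ} {c : ℂ} {g : Hahn RatLam}

theorem expMultSum_add_expMult (hj : 1 ≤ j) :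
    expMultSum p n a c j + expMult p n a c j = ∑ i ∈ Finset.Icc 1 j, expMult p n a c i := by
  rw [expMultSum, ← Finset.sum_Ico_succ_top hj]
  rfl

theorem frobeniusEq_iff (hp : 2 ≤ p) (h0 : a 0 ≠ 0) (hj : j ∈ Finset.Icc 1 (numSlopes p n a)) :
    FrobeniusEq p hp n a j c g ↔ mahlerOp p hp n a g =
      HahnSeries.single (minHeight p n a (-slope p n a j))
        ((RatFunc.X - RatFunc.C c) ^ ∑ i ∈ Finset.Icc 1 j, expMult p n a c i) := by
  rw [FrobeniusEq, opLam_eq_iff, order_sub_nu_eq_minHeight hp h0 hj,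
    expMultSum_add_expMult (Finset.mem_Icc.1 hj).1]

theorem existsUnique_frobeniusEq (hp : 2 ≤ p) (h0 : a 0 ≠ 0)
    (hj : j ∈ Finset.Icc 1 (numSlopes p n a)) : ∃! g, FrobeniusEq p hp n a j c g := by
  have hM := mahlerOp_isTriangular (n := n) hp h0
  obtain ⟨g, hg⟩ := hM.surjective_op (HahnSeries.single (minHeight p n a (-slope p n a j))
    ((RatFunc.X - RatFunc.C c) ^ ∑ i ∈ Finset.Icc 1 j, expMult p n a c i))
  refine ⟨g, (frobeniusEq_iff hp h0 hj).2 hg, fun g' hg' => hM.injective ?_⟩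
  rw [(frobeniusEq_iff hp h0 hj).1 hg', hg]

theorem FrobeniusEq.ne_zero {hp : 2 ≤ p} (hg : FrobeniusEq p hp n a j c g) (h0 : a 0 ≠ 0)
    (hj : j ∈ Finset.Icc 1 (numSlopes p n a)) : g ≠ 0 := by
  rintro rfl
  have := (frobeniusEq_iff hp h0 hj).1 hg
  rw [map_zero] at this
  exact HahnSeries.single_ne_zero (pow_ne_zero _ (X_sub_C_ne_zero c)) this.symm

theorem FrobeniusEq.order_eq {hp : 2 ≤ p} (hg : FrobeniusEq p hp n a j c g) (h0 : a 0 ≠ 0)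
    (hj : j ∈ Finset.Icc 1 (numSlopes p n a)) : g.order = -slope p n a j := by
  refine (minHeight_strictMono (p := p) (n := n) hp h0).injective ?_
  rw [← (mahlerOp_isTriangular hp h0).order_map (hg.ne_zero h0 hj),
    (frobeniusEq_iff hp h0 hj).1 hg,
    HahnSeries.order_single (pow_ne_zero _ (X_sub_C_ne_zero c))]

/-- Balance of the recursion: the guaranteed order at `γ` plus the loss at `γ` does not exceed the
order guaranteed below `γ`. The assumption on `γ` ensures that a slope met at `γ` has index at most
`j`, so that its multiplicity is in the budget. -/
theorem rootMultiplicity_add_sum_le (hp : 2 ≤ p) (h0 : a 0 ≠ 0)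
    (hj : j ∈ Finset.Icc 1 (numSlopes p n a)) (hc : c ≠ 0) {γ : ℚ} (hγ : -slope p n a j ≤ γ) :
    (∑ i ∈ Finset.Icc 1 j with γ < -slope p n a i, expMult p n a c i) +
        (charPolyAt p n a γ).rootMultiplicity c ≤
      ∑ i ∈ Finset.Icc 1 j with γ ≤ -slope p n a i, expMult p n a c i := by
  by_cases h : ∃ i ∈ Finset.Icc 1 (numSlopes p n a), γ = -slope p n a i
  · obtain ⟨i, hi, rfl⟩ := h
    have hij : i ≤ j := by
      by_contra hij
      have := slope_lt hp h0 (Finset.mem_Icc.1 hj).1 (not_le.1 hij) (Finset.mem_Icc.1 hi).2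
      linarith
    rw [← expMult_eq_rootMultiplicity hp h0 hc, add_comm, ← Finset.sum_insert (by simp)]
    refine Finset.sum_le_sum_of_subset fun l hl => ?_
    rcases Finset.mem_insert.1 hl with rfl | hl
    · exact Finset.mem_filter.2
        ⟨Finset.mem_Icc.2 ⟨(Finset.mem_Icc.1 hi).1, hij⟩, le_rfl⟩
    · rw [Finset.mem_filter] at hl ⊢
      exact ⟨hl.1, hl.2.le⟩
  · push Not at h
    rw [Polynomial.rootMultiplicity_eq_zero (eval_charPolyAt_ne_zero hp h0 hc h), add_zero]
    refine Finset.sum_le_sum_of_subset fun l hl => ?_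
    rw [Finset.mem_filter] at hl ⊢
    exact ⟨hl.1, hl.2.le⟩

/-- At the least exponent violating the bound, which exists since the support of `g` is
well-ordered, all lower coefficients and the right-hand side vanish at `c` to high enough order to
survive the division by `χ_γ`. -/
theorem FrobeniusEq.coeff_mem {hp : 2 ≤ p} (hg : FrobeniusEq p hp n a j c g) (h0 : a 0 ≠ 0)
    (hj : j ∈ Finset.Icc 1 (numSlopes p n a)) (hc : c ≠ 0) (γ : ℚ) :
    g.coeff γ ∈ vanishingOrderGE c
      (∑ i ∈ Finset.Icc 1 j with γ < -slope p n a i, expMult p n a c i) := by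
  let B : Set ℚ := {γ | g.coeff γ ∉ vanishingOrderGE c
      (∑ i ∈ Finset.Icc 1 j with γ < -slope p n a i, expMult p n a c i)}
  have hB : B ⊆ g.support := fun γ hγ h => hγ (by
    rw [h]
    exact zero_mem _)
  by_contra hγ
  have hwf : B.IsWF := g.isWF_support.mono hB
  have hne : B.Nonempty := ⟨γ, hγ⟩
  set γ₀ := hwf.min hne
  have hmem : γ₀ ∈ B := hwf.min_mem hne
  have hlow : -slope p n a j ≤ γ₀ := by
    rw [← hg.order_eq h0 hj]
    exact HahnSeries.order_le_of_coeff_ne_zero (hB hmem)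
  have hle := rootMultiplicity_add_sum_le hp h0 hj hc hlow
  refine hmem (coeff_mem_of_coeff_lt_mem (n := n) (a := a) hp h0 ?_ fun δ hδ => ?_)
  · rw [(frobeniusEq_iff hp h0 hj).1 hg, HahnSeries.coeff_single]
    split_ifs
    · refine vanishingOrderGE_antitone
        (hle.trans (Finset.sum_le_sum_of_subset (Finset.filter_subset _ _))) ⟨1, ?_, by simp⟩
      simpa using noPoleAt_algebraMap (c := c) 1
    · exact zero_mem _
  · refine vanishingOrderGE_antitone (hle.trans (Finset.sum_le_sum_of_subset fun i hi => ?_))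
      (not_not.1 fun h => hwf.not_lt_min hne h hδ)
    rw [Finset.mem_filter] at hi ⊢
    exact ⟨hi.1, hδ.trans_le hi.2⟩

theorem FrobeniusEq.leadingCoeff_eq {hp : 2 ≤ p} (hg : FrobeniusEq p hp n a j c g)
    (h0 : a 0 ≠ 0) (hj : j ∈ Finset.Icc 1 (numSlopes p n a)) :
    g.leadingCoeff =
      (RatFunc.X : RatLam) ^ (-(slopeMultSum p n a j : ℤ)) *
        RatFunc.C ((∏ i ∈ Finset.Icc 1 j, ((exponents p n a i).map fun d => -d).prod) /
          (a 0).leadingCoeff) *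
        ((RatFunc.X - RatFunc.C c) ^ (expMultSum p n a c j + expMult p n a c j) /
          ((exponents p n a j).map fun d => RatFunc.X - RatFunc.C d).prod) := by
  have hj' := Finset.mem_Icc.1 hj
  have hM := mahlerOp_isTriangular (n := n) hp h0
  have hlead := hM.coeff_lead g _ (coeff_eq_zero_of_order_eq (hg.order_eq h0 hj))
  rw [(frobeniusEq_iff hp h0 hj).1 hg, HahnSeries.coeff_single_same, (exists_charPoly_eq hp h0 hj).1,
    map_mul, map_mul, map_pow, map_multiset_prod, Multiset.map_map, RatFunc.algebraMap_X,
    RatFunc.algebraMap_C] at hlead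
  simp only [Function.comp_def, ← X_sub_C_eq] at hlead
  have hα : (a (alpha p n a j)).leadingCoeff ≠ 0 :=
    HahnSeries.leadingCoeff_ne_zero.2 (isVertex_alpha hp h0 hj'.2).2.1
  have hC : (∏ i ∈ Finset.Icc 1 j, ((exponents p n a i).map fun d => -d).prod) /
      (a 0).leadingCoeff = (a (alpha p n a j)).leadingCoeff⁻¹ := by
    rw [div_eq_iff (HahnSeries.leadingCoeff_ne_zero.2 h0), ← prod_neg_exponents hp h0 hj'.2,
      inv_mul_cancel_left₀ hα]
  have hprod : ((exponents p n a j).map fun d => (RatFunc.X - RatFunc.C d : RatLam)).prod ≠ 0 := by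
    rw [Ne, Multiset.prod_eq_zero_iff, Multiset.mem_map]
    rintro ⟨d, -, hd⟩
    exact X_sub_C_ne_zero d hd
  have hCα : (RatFunc.C (a (alpha p n a j)).leadingCoeff : RatLam) ≠ 0 := (map_ne_zero _).2 hα
  have hX := pow_ne_zero (alpha p n a (j - 1)) (RatFunc.X_ne_zero (K := ℂ))
  rw [HahnSeries.leadingCoeff_eq, hg.order_eq h0 hj, hC, expMultSum_add_expMult hj'.1, hlead,
    slopeMultSum_eq hp h0 hj'.1 hj'.2, map_inv₀, zpow_neg, zpow_natCast]
  field_simp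

end Solutions

end Mahler

theorem mainTheorem3 (p : ℕ) (hp : 2 ≤ p) (n : ℕ) (a : ℕ → Mahler.Hahn ℂ)
    (h0 : a 0 ≠ 0) (hn : a n ≠ 0)
    (j : ℕ) (hj : j ∈ Finset.Icc 1 (Mahler.numSlopes p n a))
    (c : ℂ) (hc : c ∈ Mahler.exponents p n a j) :
    (∃! g : Mahler.Hahn Mahler.RatLam, Mahler.FrobeniusEq p hp n a j c g) ∧
    ∀ g : Mahler.Hahn Mahler.RatLam, Mahler.FrobeniusEq p hp n a j c g →
      (∀ γ : ℚ, Mahler.NoPoleAt (g.coeff γ) c) ∧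
      g.orderTop = ((-Mahler.slope p n a j : ℚ) : WithTop ℚ) ∧
      g.leadingCoeff =
        (RatFunc.X : Mahler.RatLam) ^ (-(Mahler.slopeMultSum p n a j : ℤ)) *
          RatFunc.C ((∏ i ∈ Finset.Icc 1 j,
              ((Mahler.exponents p n a i).map fun d => -d).prod) / (a 0).leadingCoeff) *
          ((RatFunc.X - RatFunc.C c) ^
              (Mahler.expMultSum p n a c j + Mahler.expMult p n a c j) /
            ((Mahler.exponents p n a j).map fun d => RatFunc.X - RatFunc.C d).prod) := by
  have hc0 : c ≠ 0 := (Multiset.mem_filter.1 hc).2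
  refine ⟨Mahler.existsUnique_frobeniusEq hp h0 hj, fun g hg => ⟨fun γ => ?_, ?_, ?_⟩⟩
  · exact Mahler.noPoleAt_of_mem (hg.coeff_mem h0 hj hc0 γ)
  · rw [← HahnSeries.order_eq_orderTop_of_ne_zero (hg.ne_zero h0 hj), hg.order_eq h0 hj]
  · exact hg.leadingCoeff_eq h0 hj
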